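/- A perfect matching $M$ is a finite set of pairwise disjoint closed segments in the plane such that no three of the endpoints (the vertices of $M$) are collinear. Given an ordering of the segments of $M$, the corresponding extension of $M$ is obtained by taking the segments one after the other and extending each of them by a ray in both directions; each ray stops at the first point of another segment of $M$ or of a previous extension that it hits, and goes to infinity if it hits none. The segments and their extensions subdivide the plane into cells (the connected components of the complement of their union). The dual multigraph of the extension has these cells as its vertices and has, for every vertex $v$ of $M$, one edge joining the two cells that have $v$ on their boundary. We say that $M$ satisfies the Two Trees Conjecture if $M$ has an extension whose dual multigraph has an edge-partition into two trees such that, for every segment $vw$ of $M$, the edge corresponding to $v$ and the edge corresponding to $w$ are in different trees. **Theorem.** Every perfect matching $M$ consisting of horizontal and vertical segments satisfies the Two Trees Conjecture. Moreover, for every extension of $M$ in which all horizontal segments are extended before all vertical segments, every vertex of $M$ is on the boundary of exactly two cells, the edges of the dual multigraph that correspond to left endpoints of horizontal segments and to bottom endpoints of vertical segments form a spanning tree of the dual multigraph, and the edges that correspond to right endpoints of horizontal segments and to top endpoints of vertical segments form another spanning tree. -/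

import Mathlib

/-- The plane. -/
abbrev Plane : Type := ℝ × ℝ

/-- The closed segment spanned by an unordered pair of points. -/
def closedSeg (e : Sym2 Plane) : Set Plane := convexHull ℝ {x | x ∈ e}

/-- The segment is horizontal. -/
def IsHorizontal (e : Sym2 Plane) : Prop := ∀ a ∈ e, ∀ b ∈ e, a.2 = b.2

/-- The segment is vertical. -/
def IsVertical (e : Sym2 Plane) : Prop := ∀ a ∈ e, ∀ b ∈ e, a.1 = b.1

/-- A (non-crossing, geometric) perfect matching whose vertices are in general position. -/
structure PerfectMatching where
  /-- the vertices -/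
  verts : Finset Plane
  /-- the edges, each given by its two endpoints -/
  edges : Finset (Sym2 Plane)
  not_isDiag : ∀ e ∈ edges, ¬ e.IsDiag
  mem_verts : ∀ e ∈ edges, ∀ v ∈ e, v ∈ verts
  general_position : ∀ a ∈ verts, ∀ b ∈ verts, ∀ c ∈ verts, a ≠ b → b ≠ c → a ≠ c →
    ¬ Collinear ℝ {a, b, c}
  non_crossing : ∀ e ∈ edges, ∀ f ∈ edges, e ≠ f →
    ∀ x, x ∈ closedSeg e → x ∈ closedSeg f → x ∈ e ∧ x ∈ f
  degree_one : ∀ v ∈ verts, ∃! e, e ∈ edges ∧ v ∈ e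

namespace PerfectMatching

variable (M : PerfectMatching)

/-- The list `l` enumerates the edges of `M`, each exactly once. -/
def IsOrdering (l : List (Sym2 Plane)) : Prop := l.Nodup ∧ ∀ e, e ∈ l ↔ e ∈ M.edges

/-- What can block a ray that extends `e`, if `prev` is the union of the previous extensions:
the other segments and `prev`. -/
def obstacles (prev : Set Plane) (e : Sym2 Plane) : Set Plane :=
  (⋃ f ∈ M.edges, ⋃ _ : f ≠ e, closedSeg f) ∪ prev

/-- The extension of `e`: from each endpoint `v` of `e`, with other endpoint `w`, the part of the
ray from `v` in direction `v - w` up to and including the first point in an obstacle (the whole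
ray, if it meets no obstacle). -/
def newRays (prev : Set Plane) (e : Sym2 Plane) : Set Plane :=
  {x | ∃ v w : Plane, e = s(v, w) ∧ ∃ t : ℝ, 0 ≤ t ∧ x = v + t • (v - w) ∧
    ∀ u : ℝ, 0 ≤ u → u < t → v + u • (v - w) ∉ M.obstacles prev e}

/-- The union of the segments and rays obtained by extending the segments in the order of `l`. -/
def extension (l : List (Sym2 Plane)) : Set Plane :=
  l.foldl (fun prev e => prev ∪ M.newRays prev e) ∅

/-- The union of all segments of `M` and of their extensions in the order of `l`. -/
def drawing (l : List (Sym2 Plane)) : Set Plane :=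
  (⋃ e ∈ M.edges, closedSeg e) ∪ M.extension l

/-- The (open) cells of the subdivision: the connected components of the complement of the
drawing. -/
def cells (l : List (Sym2 Plane)) : Set (Set Plane) :=
  {c | ∃ x ∈ (M.drawing l)ᶜ, c = connectedComponentIn (M.drawing l)ᶜ x}

/-- The dual multigraph: its vertices are the cells, and every vertex `v` of `M` is an edge that
joins the two cells that have `v` on their boundary. -/
def dual (l : List (Sym2 Plane)) : Graph (Set Plane) Plane where
  vertexSet := M.cells l
  IsLink v x y := v ∈ M.verts ∧ x ≠ y ∧ {c | c ∈ M.cells l ∧ v ∈ frontier c} = {x, y}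
  isLink_symm := fun _ _ => ⟨fun x y h => ⟨h.1, h.2.1.symm, by rw [h.2.2, Set.pair_comm]⟩⟩
  eq_or_eq_of_isLink_of_isLink := by
    rintro v x y x' y' ⟨-, -, h⟩ ⟨-, -, h'⟩
    have hx : x ∈ ({x', y'} : Set (Set Plane)) := by
      rw [← h', h]; exact Set.mem_insert _ _
    simpa using hx
  left_mem_of_isLink := by
    rintro v x y ⟨-, -, h⟩
    have hx : x ∈ {c | c ∈ M.cells l ∧ v ∈ frontier c} := by
      rw [h]; exact Set.mem_insert _ _
    exact hx.1

/-- The left endpoints of the horizontal segments and the bottom endpoints of the vertical ones. -/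
def leftBottom : Set Plane :=
  {v | ∃ w, s(v, w) ∈ M.edges ∧ ((v.2 = w.2 ∧ v.1 < w.1) ∨ (v.1 = w.1 ∧ v.2 < w.2))}

/-- The right endpoints of the horizontal segments and the top endpoints of the vertical ones. -/
def rightTop : Set Plane :=
  {v | ∃ w, s(v, w) ∈ M.edges ∧ ((v.2 = w.2 ∧ w.1 < v.1) ∨ (v.1 = w.1 ∧ w.2 < v.2))}

end PerfectMatching

/-- A multigraph is connected: it has a vertex, and any two vertices are joined by a walk. -/
def MultigraphConnected {α β : Type*} (G : Graph α β) : Prop :=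
  G.vertexSet.Nonempty ∧ ∀ x ∈ G.vertexSet, ∀ y ∈ G.vertexSet, Relation.ReflTransGen G.Adj x y

/-- A multigraph has no cycle. A cycle of length `k + 1` has distinct vertices and distinct edges
(indices are taken modulo `k + 1`); loops and pairs of parallel edges are cycles. -/
def MultigraphAcyclic {α β : Type*} (G : Graph α β) : Prop :=
  ¬ ∃ (k : ℕ) (x : Fin (k + 1) → α) (e : Fin (k + 1) → β),
    Function.Injective x ∧ Function.Injective e ∧ ∀ i, G.IsLink (e i) (x i) (x (i + 1))

/-- A multigraph is a tree. -/
def MultigraphIsTree {α β : Type*} (G : Graph α β) : Prop :=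
  MultigraphConnected G ∧ MultigraphAcyclic G

/-- `M` has the property that the Two Trees Conjecture asserts: for some extension of `M`, the
edges of the dual multigraph are partitioned into two trees, and the two edges that arise from
the endpoints of one segment are always in different trees. -/
def PerfectMatching.SatisfiesTwoTrees (M : PerfectMatching) : Prop :=
  ∃ l, M.IsOrdering l ∧ ∃ T₁ T₂ : Graph (Set Plane) Plane,
    T₁ ≤ M.dual l ∧ T₂ ≤ M.dual l ∧ MultigraphIsTree T₁ ∧ MultigraphIsTree T₂ ∧
    Disjoint T₁.edgeSet T₂.edgeSet ∧ T₁.edgeSet ∪ T₂.edgeSet = (M.dual l).edgeSet ∧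
    ∀ v w, s(v, w) ∈ M.edges →
      (v ∈ T₁.edgeSet ∧ w ∈ T₂.edgeSet) ∨ (v ∈ T₂.edgeSet ∧ w ∈ T₁.edgeSet)

/-! After extension, the pieces are possibly unbounded intervals on distinct lines, no two cross,
and each end lies in the relative interior of a perpendicular piece (`SegSystem`). This alone forces
the cells to be open rectangles, each side of which is at infinity or contained in one piece
(`SegSystem.exists_cell`, `SegSystem.complCells_D`).

No counting is needed for the tree of left and bottom endpoints: its edges are oriented towards a
root. Regard each such endpoint as a door in its piece. If the door of the piece under a cell lies
in the bottom side of the cell, the parent is the cell below it. Otherwise the cell moves along its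
floor towards that door, through its left or right wall. Cells without a floor move left, and the
lower left cell is the root.

The wall has its own door in the right place because horizontal segments are extended first. A
horizontal piece that meets a vertical piece below the bottom endpoint of its segment passes
through, so the vertical piece stops there. Hence the two cells at the door of a wall stand on the
same floor (`SegSystem.Openings.bot_le`), and a wall met on the way to the door of the floor has its
own door on the side of the cell (`lt_top_side`, `bot_side_lt`). The height of the floor, and then
the number of walls still to be passed, decreases from a cell to its parent. Every door is the
parent edge of one of its two cells and every cell except the root has one parent edge, which gives
a tree (`multigraphIsTree_of_parent`).

The half turn `SegFamily.neg` exchanges left and bottom with right and top and keeps the order of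
the two directions, so it yields the second tree. -/

open Set Topology

/-! ### Segment systems and open rectangles -/

/-- `x` lies strictly between two elements of `s`. -/
def IsInner (s : Set ℝ) (x : ℝ) : Prop := (∃ u ∈ s, u < x) ∧ ∃ w ∈ s, x < w

/-- A finite system of horizontal pieces `I i × {Y i}` and vertical pieces `{X j} × J j`, possibly
unbounded, that do not cross and each of which ends in the relative interior of another piece. -/
structure SegSystem (ι κ : Type*) where
  /-- heights of the horizontal pieces -/
  Y : ι → ℝ
  /-- horizontal pieces -/
  I : ι → Set ℝ
  /-- abscissas of the vertical pieces -/
  X : κ → ℝ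
  /-- vertical pieces -/
  J : κ → Set ℝ
  Y_inj : Function.Injective Y
  X_inj : Function.Injective X
  I_conn : ∀ i, (I i).OrdConnected
  J_conn : ∀ j, (J j).OrdConnected
  end_h : ∀ i x x', x ∈ I i → x' ∉ I i → ∃ j, X j ∈ uIcc x x' ∧ X j ∈ I i ∧ IsInner (J j) (Y i)
  end_v : ∀ j y y', y ∈ J j → y' ∉ J j → ∃ i, Y i ∈ uIcc y y' ∧ Y i ∈ J j ∧ IsInner (I i) (X j)
  not_cross : ∀ i j, IsInner (I i) (X j) → ¬ IsInner (J j) (Y i)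

/-- Bounds of an axis-parallel open rectangle. -/
structure Rect where
  /-- left bound -/
  l : EReal
  /-- right bound -/
  r : EReal
  /-- lower bound -/
  b : EReal
  /-- upper bound -/
  t : EReal

namespace Rect

/-- The open rectangle with the given bounds. -/
def box (q : Rect) : Set Plane := {p | (q.l < p.1 ∧ (p.1 : EReal) < q.r) ∧ q.b < p.2 ∧ (p.2 : EReal) < q.t}

/-- Reflection in the diagonal. -/
def swap (q : Rect) : Rect := ⟨q.b, q.t, q.l, q.r⟩

lemma isOpen_box (q : Rect) : IsOpen q.box := by
  have h1 : Continuous fun p : Plane => (p.1 : EReal) :=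
    continuous_coe_real_ereal.comp continuous_fst
  have h2 : Continuous fun p : Plane => (p.2 : EReal) :=
    continuous_coe_real_ereal.comp continuous_snd
  exact ((isOpen_lt continuous_const h1).inter (isOpen_lt h1 continuous_const)).inter
    ((isOpen_lt continuous_const h2).inter (isOpen_lt h2 continuous_const))

lemma of_mem_closure_box {q : Rect} {p : Plane} (h : p ∈ closure q.box) :
    (q.l ≤ p.1 ∧ (p.1 : EReal) ≤ q.r) ∧ q.b ≤ p.2 ∧ (p.2 : EReal) ≤ q.t := by
  have h1 : Continuous fun p : Plane => (p.1 : EReal) :=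
    continuous_coe_real_ereal.comp continuous_fst
  have h2 : Continuous fun p : Plane => (p.2 : EReal) :=
    continuous_coe_real_ereal.comp continuous_snd
  have hc : IsClosed {p : Plane | (q.l ≤ p.1 ∧ (p.1 : EReal) ≤ q.r) ∧ q.b ≤ p.2 ∧
      (p.2 : EReal) ≤ q.t} :=
    ((isClosed_le continuous_const h1).inter (isClosed_le h1 continuous_const)).inter
    ((isClosed_le continuous_const h2).inter (isClosed_le h2 continuous_const))
  refine closure_minimal ?_ hc h
  intro p hp
  exact ⟨⟨hp.1.1.le, hp.1.2.le⟩, hp.2.1.le, hp.2.2.le⟩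

lemma isPreconnected_box (q : Rect) : IsPreconnected q.box := by
  have h : ∀ a b : EReal, {x : ℝ | a < x ∧ (x : EReal) < b}.OrdConnected := fun a b =>
    ⟨fun x hx y hy z hz => ⟨lt_of_lt_of_le hx.1 (EReal.coe_le_coe_iff.2 hz.1),
      lt_of_le_of_lt (EReal.coe_le_coe_iff.2 hz.2) hy.2⟩⟩
  have := (h q.l q.r).isPreconnected.prod (h q.b q.t).isPreconnected
  exact this

lemma exists_real_between {a b : EReal} (h : a < b) : ∃ x : ℝ, a < x ∧ (x : EReal) < b := by
  obtain ⟨x, hx⟩ := EReal.lt_iff_exists_real_btwn.1 h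
  exact ⟨x, hx⟩

/-- Cells as point sets can thus be replaced by their bounds, on which parents and ranks are
defined. -/
lemma box_injective {q q' : Rect} (hl : q.l < q.r) (hb : q.b < q.t) (h : q.box = q'.box) :
    q = q' := by
  have key : ∀ {a b a' b' : EReal}, a < b →
      (∀ x : ℝ, (a < x ∧ (x : EReal) < b) ↔ (a' < x ∧ (x : EReal) < b')) → a = a' ∧ b = b' := by
    intro a b a' b' hab hx
    obtain ⟨z, hz⟩ := exists_real_between hab
    have hz' := (hx z).1 hz
    refine ⟨le_antisymm ?_ ?_, le_antisymm ?_ ?_⟩ <;> refine le_of_not_gt fun hlt => ?_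
    · obtain ⟨x, hx1, hx2⟩ := exists_real_between hlt
      exact absurd ((hx x).2 ⟨hx1, (hx2.trans hz.1).trans hz'.2⟩).1 hx2.not_gt
    · obtain ⟨x, hx1, hx2⟩ := exists_real_between hlt
      exact absurd ((hx x).1 ⟨hx1, (hx2.trans hz'.1).trans hz.2⟩).1 hx2.not_gt
    · obtain ⟨x, hx1, hx2⟩ := exists_real_between hlt
      exact absurd ((hx x).1 ⟨(hz.1.trans hz'.2).trans hx1, hx2⟩).2 hx1.not_gt
    · obtain ⟨x, hx1, hx2⟩ := exists_real_between hlt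
      exact absurd ((hx x).2 ⟨(hz'.1.trans hz.2).trans hx1, hx2⟩).2 hx1.not_gt
  obtain ⟨x, hx⟩ := exists_real_between hl
  obtain ⟨y, hy⟩ := exists_real_between hb
  have hxy : ((x, y) : Plane) ∈ q'.box := by
    rw [← h]; exact ⟨hx, hy⟩
  have e1 := key hl (a' := q'.l) (b' := q'.r) fun z => by
    have := Set.ext_iff.1 h (z, y)
    exact ⟨fun hz => (this.1 ⟨hz, hy⟩).1, fun hz => (this.2 ⟨hz, hxy.2⟩).1⟩
  have e2 := key hb (a' := q'.b) (b' := q'.t) fun z => by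
    have := Set.ext_iff.1 h (x, z)
    exact ⟨fun hz => (this.1 ⟨hx, hz⟩).2, fun hz => (this.2 ⟨hxy.1, hz⟩).2⟩
  cases q; cases q'
  simp_all

end Rect

/-- The connected components of the complement of a set. -/
def complCells (D : Set Plane) : Set (Set Plane) :=
  {c | ∃ x ∈ Dᶜ, c = connectedComponentIn Dᶜ x}

lemma exists_ereal_left {A : Set ℝ} (hA : A.Finite) {x : ℝ} (hx : x ∉ A) :
    ∃ l : EReal, l < x ∧ (∀ a ∈ A, l < a → x < a) ∧ (l = ⊥ ∨ ∃ a ∈ A, l = a) := by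
  rcases (A ∩ Iio x).eq_empty_or_nonempty with h | h
  · refine ⟨⊥, EReal.bot_lt_coe x, fun a ha _ => ?_, Or.inl rfl⟩
    by_contra hxa
    have hne : a ≠ x := fun e => hx (e ▸ ha)
    exact (h ▸ (⟨ha, lt_of_le_of_ne (not_lt.1 hxa) hne⟩ : a ∈ A ∩ Iio x) : a ∈ (∅ : Set ℝ))
  · obtain ⟨m, hm, hmax⟩ := Set.exists_max_image (A ∩ Iio x) id (hA.inter_of_left _) h
    refine ⟨m, by exact_mod_cast hm.2, fun a ha hma => ?_, Or.inr ⟨m, hm.1, rfl⟩⟩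
    by_contra hxa
    have hne : a ≠ x := fun e => hx (e ▸ ha)
    exact absurd (hmax a ⟨ha, lt_of_le_of_ne (not_lt.1 hxa) hne⟩)
      (not_le.2 (by exact_mod_cast hma))

lemma exists_ereal_right {A : Set ℝ} (hA : A.Finite) {x : ℝ} (hx : x ∉ A) :
    ∃ r : EReal, x < r ∧ (∀ a ∈ A, (a : EReal) < r → a < x) ∧ (r = ⊤ ∨ ∃ a ∈ A, r = a) := by
  rcases (A ∩ Ioi x).eq_empty_or_nonempty with h | h
  · refine ⟨⊤, EReal.coe_lt_top x, fun a ha _ => ?_, Or.inl rfl⟩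
    by_contra hxa
    have hne : x ≠ a := fun e => hx (e ▸ ha)
    exact (h ▸ (⟨ha, lt_of_le_of_ne (not_lt.1 hxa) hne⟩ : a ∈ A ∩ Ioi x) : a ∈ (∅ : Set ℝ))
  · obtain ⟨m, hm, hmin⟩ := Set.exists_min_image (A ∩ Ioi x) id (hA.inter_of_left _) h
    refine ⟨m, by exact_mod_cast hm.2, fun a ha hma => ?_, Or.inr ⟨m, hm.1, rfl⟩⟩
    by_contra hxa
    have hne : x ≠ a := fun e => hx (e ▸ ha)
    exact absurd (hmin a ⟨ha, lt_of_le_of_ne (not_lt.1 hxa) hne⟩)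
      (not_le.2 (by exact_mod_cast hma))

lemma lt_lt_of_mem_uIcc {a b : EReal} {x y z : ℝ} (hx : a < x ∧ (x : EReal) < b)
    (hy : a < y ∧ (y : EReal) < b) (hz : z ∈ uIcc x y) : a < z ∧ (z : EReal) < b := by
  rcases mem_uIcc.1 hz with h | h
  · exact ⟨hx.1.trans_le (by exact_mod_cast h.1), lt_of_le_of_lt (by exact_mod_cast h.2) hy.2⟩
  · exact ⟨hy.1.trans_le (by exact_mod_cast h.1), lt_of_le_of_lt (by exact_mod_cast h.2) hx.2⟩

/-! ### Cells of a segment system are rectangles -/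

namespace SegSystem

variable {ι κ : Type*} (S : SegSystem ι κ)

/-- The union of all pieces. -/
def D : Set Plane := {p | (∃ i, p.2 = S.Y i ∧ p.1 ∈ S.I i) ∨ ∃ j, p.1 = S.X j ∧ p.2 ∈ S.J j}

/-- Reflection in the diagonal. -/
def swap : SegSystem κ ι :=
  ⟨S.X, S.J, S.Y, S.I, S.X_inj, S.Y_inj, S.J_conn, S.I_conn, S.end_v, S.end_h,
    fun i j h h' => S.not_cross j i h' h⟩

lemma mem_swap_D {x y : ℝ} : ((x, y) : Plane) ∈ S.swap.D ↔ ((y, x) : Plane) ∈ S.D := or_comm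

lemma mem_I_of_inner {i : ι} {x : ℝ} (h : IsInner (S.I i) x) : x ∈ S.I i := by
  obtain ⟨⟨u, hu, hux⟩, w, hw, hxw⟩ := h
  exact (S.I_conn i).out hu hw ⟨hux.le, hxw.le⟩

lemma mem_J_of_inner {j : κ} {y : ℝ} (h : IsInner (S.J j) y) : y ∈ S.J j :=
  S.swap.mem_I_of_inner h

/-- The rectangle `q` is a cell: it avoids the pieces, and each of its sides is at infinity or
contained in a piece. -/
structure IsCell (q : Rect) : Prop where
  lt_h : q.l < q.r
  lt_v : q.b < q.t
  disj : ∀ p ∈ q.box, p ∉ S.D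
  left : q.l = ⊥ ∨ ∃ j, q.l = S.X j ∧ ∀ y : ℝ, q.b ≤ y → y ≤ q.t → y ∈ S.J j
  right : q.r = ⊤ ∨ ∃ j, q.r = S.X j ∧ ∀ y : ℝ, q.b ≤ y → y ≤ q.t → y ∈ S.J j
  bot : q.b = ⊥ ∨ ∃ i, q.b = S.Y i ∧ ∀ x : ℝ, q.l ≤ x → x ≤ q.r → x ∈ S.I i
  top : q.t = ⊤ ∨ ∃ i, q.t = S.Y i ∧ ∀ x : ℝ, q.l ≤ x → x ≤ q.r → x ∈ S.I i

variable {S}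

lemma IsCell.swap {q : Rect} (h : S.IsCell q) : S.swap.IsCell q.swap :=
  ⟨h.lt_v, h.lt_h, fun p hp hD => h.disj (p.2, p.1) ⟨hp.2, hp.1⟩ (S.mem_swap_D.1 hD),
    h.bot, h.top, h.left, h.right⟩

/-- If a horizontal piece contains a point of a horizontal side of an empty rectangle, it contains
the side. -/
lemma side_subset {q : Rect} (hv : q.b < q.t) (disj : ∀ p ∈ q.box, p ∉ S.D)
    {i : ι} {x : ℝ} (hx : q.l < x ∧ (x : EReal) < q.r) (hxi : x ∈ S.I i)
    (hi : q.b = S.Y i ∨ q.t = S.Y i) {x' : ℝ} (h1 : q.l ≤ x') (h2 : (x' : EReal) ≤ q.r) :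
    x' ∈ S.I i := by
  by_contra hx'
  obtain ⟨j, hj, hji, ⟨u, hu, huY⟩, w, hw, hwY⟩ := S.end_h i x x' hxi hx'
  have hne : S.X j ≠ x' := fun e => hx' (e ▸ hji)
  have hb : q.l < S.X j ∧ (S.X j : EReal) < q.r := by
    rcases mem_uIcc.1 hj with h | h
    · exact ⟨hx.1.trans_le (by exact_mod_cast h.1),
        lt_of_lt_of_le (by exact_mod_cast lt_of_le_of_ne h.2 hne) h2⟩
    · exact ⟨lt_of_le_of_lt h1 (by exact_mod_cast lt_of_le_of_ne h.1 hne.symm),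
        lt_of_le_of_lt (by exact_mod_cast h.2) hx.2⟩
  -- The piece ends inside the side, on a vertical piece that continues strictly above and below it
  -- and therefore enters the rectangle.
  rcases hi with hi | hi
  · obtain ⟨y, hy1, hy2⟩ := Rect.exists_real_between
      (lt_min hv (by rw [hi]; exact_mod_cast hwY) : q.b < min q.t w)
    have hy3 := hy2.trans_le (min_le_right _ _)
    rw [hi] at hy1
    have hy1' : S.Y i < y := by exact_mod_cast hy1
    have hy3' : y < w := by exact_mod_cast hy3
    exact disj (S.X j, y) ⟨hb, hi ▸ hy1, hy2.trans_le (min_le_left _ _)⟩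
      (Or.inr ⟨j, rfl, (S.J_conn j).out hu hw ⟨(huY.trans hy1').le, hy3'.le⟩⟩)
  · obtain ⟨y, hy1, hy2⟩ := Rect.exists_real_between
      (max_lt hv (by rw [hi]; exact_mod_cast huY) : max q.b u < q.t)
    have hy3 := (le_max_right _ _).trans_lt hy1
    rw [hi] at hy2
    have hy1' : y < S.Y i := by exact_mod_cast hy2
    have hy3' : u < y := by exact_mod_cast hy3
    exact disj (S.X j, y) ⟨hb, (le_max_left _ _).trans_lt hy1, hi ▸ hy2⟩
      (Or.inr ⟨j, rfl, (S.J_conn j).out hu hw ⟨hy3'.le, (hy1'.trans hwY).le⟩⟩)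

/-- A rectangle around `p` that no piece crosses along the axis-parallel lines through `p` is
empty. -/
lemma disjoint_box [Finite ι] {q : Rect} {p : Plane} (hp : p ∈ q.box)
    (hX : ∀ j, p.2 ∈ S.J j → ¬ (q.l < S.X j ∧ (S.X j : EReal) < q.r))
    (hY : ∀ i, p.1 ∈ S.I i → ¬ (q.b < S.Y i ∧ (S.Y i : EReal) < q.t)) :
    ∀ p' ∈ q.box, p' ∉ S.D := by
  have noH : ∀ i x', x' ∈ S.I i → q.l < x' ∧ (x' : EReal) < q.r →
      ¬ (q.b < S.Y i ∧ (S.Y i : EReal) < q.t) := by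
    by_contra! hcon
    obtain ⟨i₀, x₀, h₀⟩ := hcon
    -- Take the intruding horizontal piece nearest to `p` in height. It ends at a vertical piece
    -- before reaching the vertical line through `p`. That piece in turn ends before the height of
    -- `p`, at a horizontal piece that is strictly nearer, since equality would be a crossing.
    obtain ⟨i, ⟨x, hxi, hx, hi⟩, hmin⟩ := Set.exists_min_image
      {i | ∃ x, x ∈ S.I i ∧ (q.l < x ∧ (x : EReal) < q.r) ∧ (q.b < S.Y i ∧ (S.Y i : EReal) < q.t)}
      (fun i => |S.Y i - p.2|) (Set.toFinite _) ⟨i₀, x₀, h₀⟩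
    obtain ⟨j, hj, hji, hin⟩ := S.end_h i x p.1 hxi fun h => hY i h hi
    have hjb := lt_lt_of_mem_uIcc hx hp.1 hj
    obtain ⟨i', hi', hij', hin'⟩ := S.end_v j (S.Y i) p.2 (S.mem_J_of_inner hin)
      fun h => hX j h hjb
    have hle := hmin i' ⟨S.X j, S.mem_I_of_inner hin', hjb, lt_lt_of_mem_uIcc hi hp.2 hi'⟩
    have hne : S.Y i' ≠ S.Y i := fun e => S.not_cross i j (S.Y_inj e ▸ hin') hin
    rcases mem_uIcc.1 hi' with h | h
    · have h3 := lt_of_le_of_ne h.1 hne.symm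
      rw [abs_of_nonpos (by linarith), abs_of_nonpos (by linarith)] at hle
      linarith
    · have h3 := lt_of_le_of_ne h.2 hne
      rw [abs_of_nonneg (by linarith), abs_of_nonneg (by linarith)] at hle
      linarith
  rintro ⟨x, y⟩ hxy (⟨i, hi, hxi⟩ | ⟨j, hj, hyj⟩)
  · exact noH i x hxi hxy.1 (hi ▸ hxy.2)
  · simp only at hj hyj
    subst hj
    obtain ⟨i, hi, hij, hin⟩ := S.end_v j y p.2 hyj fun h => hX j h hxy.1
    exact noH i (S.X j) (S.mem_I_of_inner hin) hxy.1 (lt_lt_of_mem_uIcc hxy.2 hp.2 hi)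

/-- Each side is pushed away from `p` to the nearest piece on the axis-parallel line through `p`.
Then `disjoint_box` makes the rectangle empty, and `side_subset` extends the one known contact point
to the whole side. -/
lemma exists_cell [Finite ι] [Finite κ] {p : Plane} (hpD : p ∉ S.D) :
    ∃ q, S.IsCell q ∧ p ∈ q.box := by
  have hA : p.1 ∉ S.X '' {j | p.2 ∈ S.J j} := by
    rintro ⟨j, hj, h⟩; exact hpD (Or.inr ⟨j, h.symm, hj⟩)
  have hB : p.2 ∉ S.Y '' {i | p.1 ∈ S.I i} := by
    rintro ⟨j, hj, h⟩; exact hpD (Or.inl ⟨j, h.symm, hj⟩)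
  obtain ⟨l, hl, hl1, hl2⟩ := exists_ereal_left (Set.toFinite _) hA
  obtain ⟨r, hr, hr1, hr2⟩ := exists_ereal_right (Set.toFinite _) hA
  obtain ⟨b, hb, hb1, hb2⟩ := exists_ereal_left (Set.toFinite _) hB
  obtain ⟨t, ht, ht1, ht2⟩ := exists_ereal_right (Set.toFinite _) hB
  have hp : p ∈ (⟨l, r, b, t⟩ : Rect).box := ⟨⟨hl, hr⟩, hb, ht⟩
  have hd : ∀ p' ∈ (⟨l, r, b, t⟩ : Rect).box, p' ∉ S.D := by
    refine disjoint_box hp (fun j hj h => ?_) fun i hi h => ?_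
    · exact lt_asymm (hl1 _ ⟨j, hj, rfl⟩ h.1) (hr1 _ ⟨j, hj, rfl⟩ h.2)
    · exact lt_asymm (hb1 _ ⟨i, hi, rfl⟩ h.1) (ht1 _ ⟨i, hi, rfl⟩ h.2)
  have hd' : ∀ p' ∈ (⟨l, r, b, t⟩ : Rect).swap.box, p' ∉ S.swap.D := fun p' hp' h =>
    hd (p'.2, p'.1) ⟨hp'.2, hp'.1⟩ (S.mem_swap_D.1 h)
  refine ⟨⟨l, r, b, t⟩, ⟨hl.trans hr, hb.trans ht, hd, ?_, ?_, ?_, ?_⟩, hp⟩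
  · refine hl2.imp_right ?_
    rintro ⟨_, ⟨j, hj, rfl⟩, h⟩
    exact ⟨j, h, fun y => side_subset (S := S.swap) (q := Rect.swap ⟨l, r, b, t⟩) (hl.trans hr) hd'
      hp.2 hj (Or.inl h)⟩
  · refine hr2.imp_right ?_
    rintro ⟨_, ⟨j, hj, rfl⟩, h⟩
    exact ⟨j, h, fun y => side_subset (S := S.swap) (q := Rect.swap ⟨l, r, b, t⟩) (hl.trans hr) hd'
      hp.2 hj (Or.inr h)⟩
  · refine hb2.imp_right ?_
    rintro ⟨_, ⟨i, hi, rfl⟩, h⟩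
    exact ⟨i, h, fun x => side_subset (q := ⟨l, r, b, t⟩) (hb.trans ht) hd hp.1 hi (Or.inl h)⟩
  · refine ht2.imp_right ?_
    rintro ⟨_, ⟨i, hi, rfl⟩, h⟩
    exact ⟨i, h, fun x => side_subset (q := ⟨l, r, b, t⟩) (hb.trans ht) hd hp.1 hi (Or.inr h)⟩

lemma IsCell.mem_D_of_frontier {q : Rect} (h : S.IsCell q) {p : Plane} (hp : p ∈ closure q.box)
    (hq : p ∉ q.box) : p ∈ S.D := by
  obtain ⟨⟨h1, h2⟩, h3, h4⟩ := Rect.of_mem_closure_box hp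
  by_contra hD
  refine hq ⟨⟨lt_of_le_of_ne h1 fun e => ?_, lt_of_le_of_ne h2 fun e => ?_⟩,
    lt_of_le_of_ne h3 fun e => ?_, lt_of_le_of_ne h4 fun e => ?_⟩
  · rcases h.left with h' | ⟨j, hj, hj'⟩
    · simp [h'] at e
    · exact hD (Or.inr ⟨j, by exact_mod_cast e.symm.trans hj, hj' _ h3 h4⟩)
  · rcases h.right with h' | ⟨j, hj, hj'⟩
    · simp [h'] at e
    · exact hD (Or.inr ⟨j, by exact_mod_cast e.trans hj, hj' _ h3 h4⟩)
  · rcases h.bot with h' | ⟨j, hj, hj'⟩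
    · simp [h'] at e
    · exact hD (Or.inl ⟨j, by exact_mod_cast e.symm.trans hj, hj' _ h1 h2⟩)
  · rcases h.top with h' | ⟨j, hj, hj'⟩
    · simp [h'] at e
    · exact hD (Or.inl ⟨j, by exact_mod_cast e.trans hj, hj' _ h1 h2⟩)

/-- The box is open and connected and its frontier lies in `S.D`, so a connected set that avoids
`S.D` cannot leave it. -/
lemma IsCell.component_eq {q : Rect} (h : S.IsCell q) {p : Plane} (hp : p ∈ q.box) :
    connectedComponentIn S.Dᶜ p = q.box := by
  refine subset_antisymm ?_ (q.isPreconnected_box.subset_connectedComponentIn hp h.disj)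
  have hpD : p ∈ S.Dᶜ := h.disj p hp
  refine isPreconnected_connectedComponentIn.subset_of_closure_inter_subset q.isOpen_box
    ⟨p, mem_connectedComponentIn hpD, hp⟩ ?_
  rintro x ⟨hx, hx'⟩
  by_contra hxq
  exact connectedComponentIn_subset _ _ hx' (h.mem_D_of_frontier hx hxq)

lemma IsCell.nonempty {q : Rect} (h : S.IsCell q) : q.box.Nonempty := by
  obtain ⟨x, hx⟩ := Rect.exists_real_between h.lt_h
  obtain ⟨y, hy⟩ := Rect.exists_real_between h.lt_v
  exact ⟨(x, y), hx, hy⟩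

lemma complCells_D [Finite ι] [Finite κ] : complCells S.D = Rect.box '' {q | S.IsCell q} := by
  ext c
  constructor
  · rintro ⟨x, hx, rfl⟩
    obtain ⟨q, hq, hxq⟩ := exists_cell (S := S) hx
    exact ⟨q, hq, (hq.component_eq hxq).symm⟩
  · rintro ⟨q, hq, rfl⟩
    obtain ⟨x, hx⟩ := hq.nonempty
    exact ⟨x, hq.disj x hx, (hq.component_eq hx).symm⟩

lemma IsCell.eq_of_mem {q q' : Rect} (h : S.IsCell q) (h' : S.IsCell q') {p : Plane}
    (hp : p ∈ q.box) (hp' : p ∈ q'.box) : q = q' :=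
  Rect.box_injective h.lt_h h.lt_v ((h.component_eq hp).symm.trans (h'.component_eq hp'))

/-- Slightly above the common bottom, over `x`, the two components share a point. -/
lemma IsCell.eq_of_bot {q q' : Rect} (h : S.IsCell q) (h' : S.IsCell q') {x : ℝ}
    (hx : q.l < x ∧ (x : EReal) < q.r) (hx' : q'.l < x ∧ (x : EReal) < q'.r) (hb : q.b = q'.b) :
    q = q' := by
  obtain ⟨y, hy, hy'⟩ := Rect.exists_real_between (lt_min h.lt_v (hb ▸ h'.lt_v) : q.b < min q.t q'.t)
  exact h.eq_of_mem h' (p := (x, y)) ⟨hx, hy, hy'.trans_le (min_le_left _ _)⟩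
    ⟨hx', hb ▸ hy, hy'.trans_le (min_le_right _ _)⟩

lemma IsCell.eq_of_top {q q' : Rect} (h : S.IsCell q) (h' : S.IsCell q') {x : ℝ}
    (hx : q.l < x ∧ (x : EReal) < q.r) (hx' : q'.l < x ∧ (x : EReal) < q'.r) (hb : q.t = q'.t) :
    q = q' := by
  obtain ⟨y, hy, hy'⟩ := Rect.exists_real_between (max_lt h.lt_v (hb ▸ h'.lt_v) : max q.b q'.b < q.t)
  exact h.eq_of_mem h' (p := (x, y)) ⟨hx, (le_max_left _ _).trans_lt hy, hy'⟩
    ⟨hx', (le_max_right _ _).trans_lt hy, hb ▸ hy'⟩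

/-! ### Cells at a given point of a piece -/

lemma IsCell.mem_frontier_h {q : Rect} (h : S.IsCell q) {i : ι} {x : ℝ} (hx : x ∈ S.I i)
    (hX : ∀ j, x ≠ S.X j) : ((x, S.Y i) : Plane) ∈ frontier q.box ↔
      (q.l < x ∧ (x : EReal) < q.r) ∧ (q.b = S.Y i ∨ q.t = S.Y i) := by
  have hD : ((x, S.Y i) : Plane) ∈ S.D := Or.inl ⟨i, rfl, hx⟩
  rw [q.isOpen_box.frontier_eq, mem_sdiff]
  constructor
  · rintro ⟨hc, hn⟩
    obtain ⟨⟨h1, h2⟩, h3, h4⟩ := Rect.of_mem_closure_box hc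
    have hlr : q.l < x ∧ (x : EReal) < q.r := by
      refine ⟨lt_of_le_of_ne h1 fun e => ?_, lt_of_le_of_ne h2 fun e => ?_⟩
      · rcases h.left with h' | ⟨j, hj, -⟩
        · simp [h'] at e
        · exact hX j (by exact_mod_cast e.symm.trans hj)
      · rcases h.right with h' | ⟨j, hj, -⟩
        · simp [h'] at e
        · exact hX j (by exact_mod_cast e.trans hj)
    refine ⟨hlr, ?_⟩
    by_contra! hne
    exact hn ⟨hlr, lt_of_le_of_ne h3 hne.1, lt_of_le_of_ne h4 hne.2.symm⟩
  · rintro ⟨hlr, hbt⟩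
    refine ⟨?_, fun hm => h.disj _ hm hD⟩
    have hc : Continuous fun y : ℝ => ((x, y) : Plane) := by fun_prop
    have hco : Continuous fun y : ℝ => (y : EReal) := continuous_coe_real_ereal
    rcases hbt with hb | ht
    · refine mem_closure_of_tendsto (b := 𝓝[>] (S.Y i))
        ((hc.tendsto (S.Y i)).mono_left nhdsWithin_le_nhds) ?_
      have := (hco.tendsto (S.Y i)).eventually (eventually_lt_nhds (hb ▸ h.lt_v))
      filter_upwards [nhdsWithin_le_nhds this, self_mem_nhdsWithin] with y hy hy'
      exact ⟨hlr, by rw [hb]; exact_mod_cast hy', hy⟩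
    · refine mem_closure_of_tendsto (b := 𝓝[<] (S.Y i))
        ((hc.tendsto (S.Y i)).mono_left nhdsWithin_le_nhds) ?_
      have := (hco.tendsto (S.Y i)).eventually (eventually_gt_nhds (ht ▸ h.lt_v))
      filter_upwards [nhdsWithin_le_nhds this, self_mem_nhdsWithin] with y hy hy'
      exact ⟨hlr, hy, by rw [ht]; exact_mod_cast hy'⟩

/-- Take the cell of a point over `x` that is above `S.Y i` but below every higher horizontal line:
no other height is available for its bottom. -/
lemma exists_cell_above [Finite ι] [Finite κ] {i : ι} {x : ℝ} (hx : x ∈ S.I i)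
    (hX : ∀ j, x ≠ S.X j) : ∃ q, S.IsCell q ∧ q.b = S.Y i ∧ q.l < x ∧ (x : EReal) < q.r := by
  obtain ⟨t, ht, ht1, -⟩ := exists_ereal_right (A := S.Y '' {i' | S.Y i < S.Y i'})
    (Set.toFinite _) (x := S.Y i) (by rintro ⟨i', h, h'⟩; exact absurd h' (ne_of_gt h))
  obtain ⟨y, hy, hyt⟩ := Rect.exists_real_between ht
  have hy' : S.Y i < y := by exact_mod_cast hy
  have hno : ∀ i', S.Y i < S.Y i' → y < S.Y i' := fun i' h => by
    by_contra hle
    refine lt_asymm h (ht1 _ ⟨i', h, rfl⟩ (lt_of_le_of_lt ?_ hyt))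
    exact_mod_cast not_lt.1 hle
  have hpD : ((x, y) : Plane) ∉ S.D := by
    rintro (⟨i', h, -⟩ | ⟨j, h, -⟩)
    · simp only at h
      exact absurd (hno i' (h ▸ hy')) (h ▸ lt_irrefl _)
    · exact hX j h
  obtain ⟨q, hq, hm⟩ := exists_cell hpD
  refine ⟨q, hq, le_antisymm ?_ ?_, hm.1⟩
  · rcases hq.bot with h | ⟨i', h, -⟩
    · simp [h]
    · by_contra hlt
      have h1 : S.Y i < S.Y i' := by rw [h] at hlt; exact_mod_cast not_le.1 hlt
      have h2 : S.Y i' < y := by have := hm.2.1; rw [h] at this; exact_mod_cast this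
      exact lt_asymm h2 (hno i' h1)
  · by_contra hlt
    exact hq.disj (x, S.Y i) ⟨hm.1, not_le.1 hlt, lt_trans (by exact_mod_cast hy') hm.2.2⟩
      (Or.inl ⟨i, rfl, hx⟩)

lemma exists_cell_below [Finite ι] [Finite κ] {i : ι} {x : ℝ} (hx : x ∈ S.I i)
    (hX : ∀ j, x ≠ S.X j) : ∃ q, S.IsCell q ∧ q.t = S.Y i ∧ q.l < x ∧ (x : EReal) < q.r := by
  obtain ⟨t, ht, ht1, -⟩ := exists_ereal_left (A := S.Y '' {i' | S.Y i' < S.Y i})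
    (Set.toFinite _) (x := S.Y i) (by rintro ⟨i', h, h'⟩; exact absurd h' (ne_of_lt h))
  obtain ⟨y, hyt, hy⟩ := Rect.exists_real_between ht
  have hy' : y < S.Y i := by exact_mod_cast hy
  have hno : ∀ i', S.Y i' < S.Y i → S.Y i' < y := fun i' h => by
    by_contra hle
    refine lt_asymm h (ht1 _ ⟨i', h, rfl⟩ (lt_of_lt_of_le hyt ?_))
    exact_mod_cast not_lt.1 hle
  have hpD : ((x, y) : Plane) ∉ S.D := by
    rintro (⟨i', h, -⟩ | ⟨j, h, -⟩)
    · simp only at h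
      exact absurd (hno i' (h ▸ hy')) (h ▸ lt_irrefl _)
    · exact hX j h
  obtain ⟨q, hq, hm⟩ := exists_cell hpD
  refine ⟨q, hq, le_antisymm ?_ ?_, hm.1⟩
  · by_contra hlt
    exact hq.disj (x, S.Y i) ⟨hm.1, lt_trans hm.2.1 (by exact_mod_cast hy'), not_le.1 hlt⟩
      (Or.inl ⟨i, rfl, hx⟩)
  · rcases hq.top with h | ⟨i', h, -⟩
    · simp [h]
    · by_contra hlt
      have h1 : S.Y i' < S.Y i := by rw [h] at hlt; exact_mod_cast not_le.1 hlt
      have h2 : y < S.Y i' := by have := hm.2.2; rw [h] at this; exact_mod_cast this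
      exact lt_asymm h2 (hno i' h1)

/-- A point of a horizontal piece off all vertical lines is on the boundary of exactly two cells,
one above and one below it. -/
lemma exists_cells_h [Finite ι] [Finite κ] {i : ι} {x : ℝ} (hx : x ∈ S.I i)
    (hX : ∀ j, x ≠ S.X j) : ∃ q q', S.IsCell q ∧ S.IsCell q' ∧ q.b = S.Y i ∧ q'.t = S.Y i ∧
      (q.l < x ∧ (x : EReal) < q.r) ∧ (q'.l < x ∧ (x : EReal) < q'.r) ∧ q ≠ q' ∧
      ∀ c, S.IsCell c → (((x, S.Y i) : Plane) ∈ frontier c.box ↔ c = q ∨ c = q') := by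
  obtain ⟨q, hq, hb, hlr⟩ := exists_cell_above hx hX
  obtain ⟨q', hq', ht, hlr'⟩ := exists_cell_below hx hX
  refine ⟨q, q', hq, hq', hb, ht, hlr, hlr', ?_, fun c hc => ?_⟩
  · rintro rfl
    exact absurd hq.lt_v (by rw [hb, ht]; exact lt_irrefl _)
  · rw [hc.mem_frontier_h hx hX]
    constructor
    · rintro ⟨h, h' | h'⟩
      · exact Or.inl (hc.eq_of_bot hq h hlr (h'.trans hb.symm))
      · exact Or.inr (hc.eq_of_top hq' h hlr' (h'.trans ht.symm))
    · rintro (rfl | rfl)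
      · exact ⟨hlr, Or.inl hb⟩
      · exact ⟨hlr', Or.inr ht⟩

lemma mem_frontier_swap {q : Rect} {x y : ℝ} :
    ((x, y) : Plane) ∈ frontier q.swap.box ↔ ((y, x) : Plane) ∈ frontier q.box := by
  have : q.swap.box = (Homeomorph.prodComm ℝ ℝ) ⁻¹' q.box := by
    ext p; exact and_comm
  rw [this, ← Homeomorph.preimage_frontier]
  rfl

/-- A point of a vertical piece off all horizontal lines is on the boundary of exactly two cells,
one to the right and one to the left of it. -/
lemma exists_cells_v [Finite ι] [Finite κ] {j : κ} {y : ℝ} (hy : y ∈ S.J j)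
    (hY : ∀ i, y ≠ S.Y i) : ∃ q q', S.IsCell q ∧ S.IsCell q' ∧ q.l = S.X j ∧ q'.r = S.X j ∧
      (q.b < y ∧ (y : EReal) < q.t) ∧ (q'.b < y ∧ (y : EReal) < q'.t) ∧ q ≠ q' ∧
      ∀ c, S.IsCell c → (((S.X j, y) : Plane) ∈ frontier c.box ↔ c = q ∨ c = q') := by
  obtain ⟨q, q', hq, hq', h1, h2, h3, h4, h5, h6⟩ := exists_cells_h (S := S.swap) hy hY
  refine ⟨q.swap, q'.swap, hq.swap, hq'.swap, h1, h2, h3, h4, fun h => h5 ?_, fun c hc => ?_⟩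
  · exact congrArg Rect.swap h
  · rw [show c = c.swap.swap from rfl, mem_frontier_swap]
    refine (h6 c.swap hc.swap).trans ?_
    exact or_congr ⟨fun h => congrArg Rect.swap h, fun h => congrArg Rect.swap h⟩
      ⟨fun h => congrArg Rect.swap h, fun h => congrArg Rect.swap h⟩

end SegSystem

/-! ### Trees from parent edges -/

/-- A multigraph is a tree if every vertex other than a root has a unique parent edge, every edge
is the parent edge of one of its ends, and parents have smaller rank. -/
theorem multigraphIsTree_of_parent {α β Q R : Type*} [LinearOrder R] (G : Graph α β) (φ : Q → α)
    (P : β → Q → Q → Prop) (rank : Q → R) (root : Q) {E : Set β} (hE : E.Finite)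
    (hV : G.vertexSet = range φ) (hφ : Function.Injective φ)
    (hlink : ∀ e x y, G.IsLink e x y →
      ∃ c p, P e c p ∧ (x = φ c ∧ y = φ p ∨ x = φ p ∧ y = φ c))
    (hP : ∀ e c p, P e c p → e ∈ E ∧ G.IsLink e (φ c) (φ p) ∧ rank p < rank c)
    (huniq : ∀ e e' c p p', P e c p → P e' c p' → e = e')
    (hex : ∀ c, c ≠ root → ∃ e p, P e c p) : MultigraphIsTree G := by
  -- Non-root vertices inject into `E` through their parent edges: two vertices with the same parent
  -- edge would be parents of each other, against the ranks.
  have hfin : Finite Q := by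
    have h1 : Finite {c : Q // c ≠ root} := by
      choose f p hf using hex
      have := hE.to_subtype
      refine Finite.of_injective (fun c : {c : Q // c ≠ root} => (⟨f c.1 c.2, (hP _ _ _ (hf c.1 c.2)).1⟩ : E))
        fun c c' h => ?_
      have he : f c.1 c.2 = f c'.1 c'.2 := congrArg Subtype.val h
      obtain ⟨-, hl, hr⟩ := hP _ _ _ (hf c.1 c.2)
      obtain ⟨-, hl', hr'⟩ := hP _ _ _ (hf c'.1 c'.2)
      rw [he] at hl
      rcases hl.eq_and_eq_or_eq_and_eq hl' with ⟨h1, -⟩ | ⟨h1, h2⟩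
      · exact Subtype.ext (hφ h1)
      · have e1 := congrArg rank (hφ h1)
        have e2 := congrArg rank (hφ h2)
        exact absurd e1.symm ((hr'.trans_eq e2.symm).trans hr).ne
    have h2 : ({c : Q | c ≠ root} ∪ {root}).Finite :=
      (show {c : Q | c ≠ root}.Finite from h1).union (finite_singleton root)
    refine Set.finite_univ_iff.1 (h2.subset fun c _ => ?_)
    by_cases h : c = root
    · exact Or.inr h
    · exact Or.inl h
  have hwf : WellFounded fun a b : Q => rank a < rank b :=
    @Finite.wellFounded_of_trans_of_irrefl Q hfin _ ⟨fun _ _ _ h h' => h.trans h'⟩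
      ⟨fun _ => lt_irrefl _⟩
  have hsymm : ∀ {x y}, Relation.ReflTransGen G.Adj x y → Relation.ReflTransGen G.Adj y x :=
    fun h => by
      induction h with
      | refl => exact .refl
      | tail _ h ih => exact .head h.symm ih
  have hroot : ∀ c, Relation.ReflTransGen G.Adj (φ c) (φ root) := fun c => by
    induction c using hwf.induction with
    | _ c ih =>
      by_cases h : c = root
      · rw [h]
      · obtain ⟨e, p, hp⟩ := hex c h
        obtain ⟨-, hl, hr⟩ := hP _ _ _ hp
        exact .head ⟨e, hl⟩ (ih p hr)
  refine ⟨⟨hV ▸ ⟨φ root, mem_range_self _⟩, fun x hx y hy => ?_⟩, ?_⟩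
  · rw [hV] at hx hy
    obtain ⟨c, rfl⟩ := hx
    obtain ⟨c', rfl⟩ := hy
    exact (hroot c).trans (hsymm (hroot c'))
  · rintro ⟨k, x, e, -, he, hl⟩
    have hxV : ∀ i, ∃ q, φ q = x i := fun i => by
      have := (hl i).left_mem
      rwa [hV] at this
    choose q hq using hxV
    -- At a vertex of greatest rank both cycle edges are its parent edge, so they coincide. The
    -- cycle is then a loop, which contradicts the strict decrease of rank.
    obtain ⟨i, hi⟩ := Finite.exists_max (fun i => rank (q i))
    have up : ∀ e' j, G.IsLink e' (φ (q i)) (φ (q j)) → ∃ p, P e' (q i) p := fun e' j h => by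
      obtain ⟨c, p, hcp, ⟨h1, -⟩ | ⟨h1, h2⟩⟩ := hlink _ _ _ h
      · exact ⟨p, hφ h1 ▸ hcp⟩
      · rw [← hφ h1, ← hφ h2] at hcp
        exact absurd (hP _ _ _ hcp).2.2 (hi j).not_gt
    have l1 := hl i
    rw [← hq, ← hq] at l1
    have l2 := hl (i - 1)
    rw [sub_add_cancel, ← hq, ← hq] at l2
    obtain ⟨p1, hp1⟩ := up _ _ l1
    obtain ⟨p2, hp2⟩ := up _ _ l2.symm
    have hii := he (huniq _ _ _ _ _ hp1 hp2)
    have h10 : i + 1 = i := by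
      nth_rewrite 1 [hii]; rw [sub_add_cancel]
    rw [h10] at l1
    obtain ⟨c, p, hcp, h⟩ := hlink _ _ _ l1
    have : c = p := by
      rcases h with ⟨h1, h2⟩ | ⟨h1, h2⟩
      · exact hφ (h1.symm.trans h2)
      · exact hφ (h2.symm.trans h1)
    exact absurd (hP _ _ _ hcp).2.2 (this ▸ lt_irrefl _)

/-- Needed for the half turn that carries the first tree to the second. -/
lemma complCells_preimage (f : Plane ≃ₜ Plane) (D : Set Plane) :
    complCells (f ⁻¹' D) = (f ⁻¹' ·) '' complCells D := by
  have hc : (f ⁻¹' D)ᶜ = f.symm '' Dᶜ := by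
    rw [← preimage_compl, f.symm.image_eq_preimage_symm]; rfl
  ext c
  constructor
  · rintro ⟨x, hx, rfl⟩
    refine ⟨_, ⟨f x, hx, rfl⟩, ?_⟩
    have := f.symm.image_connectedComponentIn (s := Dᶜ) (x := f x) hx
    rw [← hc, f.symm_apply_apply] at this
    rw [← this, f.symm.image_eq_preimage_symm]; rfl
  · rintro ⟨_, ⟨x, hx, rfl⟩, rfl⟩
    refine ⟨f.symm x, by rw [hc]; exact mem_image_of_mem _ hx, ?_⟩
    have := f.symm.image_connectedComponentIn hx
    rw [← hc] at this
    rw [← this, f.symm.image_eq_preimage_symm]; rfl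

/-! ### Openings and parents of cells -/

namespace SegSystem

variable {ι κ : Type*}

/-- A choice of a point `o i` on each horizontal piece and `u j` on each vertical piece, off the
lines of the pieces of the other direction, such that below `u j` no horizontal piece ends at the
`j`-th vertical piece. -/
structure Openings (S : SegSystem ι κ) (o : ι → ℝ) (u : κ → ℝ) : Prop where
  o_mem : ∀ i, o i ∈ S.I i
  u_mem : ∀ j, u j ∈ S.J j
  o_ne : ∀ i j, o i ≠ S.X j
  u_ne : ∀ i j, u j ≠ S.Y i
  free : ∀ i j, S.Y i ∈ S.J j → S.Y i < u j → S.X j ∈ S.I i → IsInner (S.I i) (S.X j)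

open Classical in
/-- The position of the opening of the horizontal piece at height `b`; minus infinity if there is
no such piece. -/
noncomputable def openAt (S : SegSystem ι κ) (o : ι → ℝ) (b : EReal) : EReal :=
  if h : ∃ i, b = S.Y i then (o h.choose : EReal) else ⊥

/-- Cells are ranked by the height of the bottom side, then by the number of vertical pieces between
the cell and the opening of its bottom side. -/
noncomputable def rank (S : SegSystem ι κ) (o : ι → ℝ) (q : Rect) : EReal ×ₗ ℕ :=
  toLex (q.b, {j | (S.openAt o q.b < S.X j ∧ (S.X j : EReal) ≤ q.l) ∨
    (q.r ≤ S.X j ∧ (S.X j : EReal) < S.openAt o q.b)}.ncard)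

/-- The opening `v` leads from the cell `c` to its parent. -/
def ParentEdge (S : SegSystem ι κ) (o : ι → ℝ) (u : κ → ℝ) (v : Plane) (c : Rect) : Prop :=
  (∃ i, v = (o i, S.Y i) ∧ c.b = S.Y i ∧ c.l < o i ∧ (o i : EReal) < c.r) ∨
  (∃ j, v = (S.X j, u j) ∧ c.l = S.X j ∧ S.openAt o c.b < S.X j) ∨
  ∃ j, v = (S.X j, u j) ∧ c.r = S.X j ∧ (S.X j : EReal) < S.openAt o c.b

/-- The opening `v` joins the cell `c` to its parent `p`. -/
def IsParent (S : SegSystem ι κ) (o : ι → ℝ) (u : κ → ℝ) (v : Plane) (c p : Rect) : Prop :=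
  (∀ c', S.IsCell c' → (v ∈ frontier c'.box ↔ c' = c ∨ c' = p)) ∧ S.rank o p < S.rank o c ∧
    S.ParentEdge o u v c

/-- The set of all openings. -/
def openings (S : SegSystem ι κ) (o : ι → ℝ) (u : κ → ℝ) : Set Plane :=
  {v | (∃ i, v = (o i, S.Y i)) ∨ ∃ j, v = (S.X j, u j)}

variable {S : SegSystem ι κ} {o : ι → ℝ} {u : κ → ℝ}

@[simp] lemma openAt_Y (i : ι) : S.openAt o (S.Y i) = o i := by
  have h : ∃ i', (S.Y i : EReal) = S.Y i' := ⟨i, rfl⟩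
  rw [openAt, dif_pos h, ← S.Y_inj (EReal.coe_injective h.choose_spec)]

-- The default value matters: it sends cells that are unbounded below to the left, towards the root.
@[simp] lemma openAt_bot : S.openAt o ⊥ = ⊥ := by
  rw [openAt, dif_neg]
  rintro ⟨i, h⟩
  simp at h

namespace Openings

/-- By `free` the horizontal piece passes through, so the vertical piece, which reaches up to `u j`,
would cross it if it went any lower. -/
lemma le_of_free (h : S.Openings o u) {i : ι} {j : κ} (h1 : S.Y i ∈ S.J j) (h2 : S.Y i < u j)
    (h3 : S.X j ∈ S.I i) {y : ℝ} (hy : y ∈ S.J j) : S.Y i ≤ y := by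
  by_contra hlt
  exact S.not_cross i j (h.free i j h1 h2 h3) ⟨⟨y, hy, not_le.1 hlt⟩, u j, h.u_mem j, h2⟩

/-- Two cells on both sides of the opening of a vertical piece have the same bottom. -/
lemma bot_le (h : S.Openings o u) {j : κ} {c c' : Rect} (hc : S.IsCell c)
    (hs : ∀ y : ℝ, c.b ≤ y → y ≤ c.t → y ∈ S.J j) (hs' : ∀ y : ℝ, c'.b ≤ y → y ≤ c'.t → y ∈ S.J j)
    (hl : c.l ≤ S.X j) (hr : S.X j ≤ c.r) (hu : c.b < u j) (hu' : (u j : EReal) < c'.t) :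
    c.b ≤ c'.b := by
  by_contra hlt
  rw [not_le] at hlt
  rcases hc.bot with hb | ⟨i, hi, hI⟩
  · rw [hb] at hlt; exact not_lt_bot hlt
  have hYu : S.Y i < u j := by rw [hi] at hu; exact_mod_cast hu
  -- If `c'` reached lower, its side would contain points of piece `j` under the floor of `c`.
  obtain ⟨y, hy, hy'⟩ := Rect.exists_real_between hlt
  have hyY : y < S.Y i := by rw [hi] at hy'; exact_mod_cast hy'
  have hyJ : y ∈ S.J j :=
    hs' y hy.le (le_trans (by exact_mod_cast (hyY.trans hYu).le) hu'.le)
  exact absurd (h.le_of_free (hs _ hi.le (hi ▸ hc.lt_v.le)) hYu (hI _ hl hr) hyJ) (not_le.2 hyY)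

/-- A ceiling below `u j` would pass through the vertical piece and leave none of it beneath, where
the side of `c` lies. -/
lemma lt_top_side (h : S.Openings o u) {j : κ} {c : Rect} (hc : S.IsCell c)
    (hs : ∀ y : ℝ, c.b ≤ y → y ≤ c.t → y ∈ S.J j)
    (hl : c.l ≤ S.X j) (hr : S.X j ≤ c.r) : (u j : EReal) < c.t := by
  by_contra hlt
  rw [not_lt] at hlt
  rcases hc.top with hb | ⟨i, hi, hI⟩
  · rw [hb] at hlt; exact not_lt.2 hlt (EReal.coe_lt_top _)
  have hYu : S.Y i < u j := by
    rw [hi] at hlt; exact lt_of_le_of_ne (by exact_mod_cast hlt) (h.u_ne i j).symm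
  obtain ⟨y, hy, hy'⟩ := Rect.exists_real_between hc.lt_v
  have hyY : y < S.Y i := by rw [hi] at hy'; exact_mod_cast hy'
  exact absurd (h.le_of_free (hs _ (hi ▸ hc.lt_v.le) hi.ge) hYu (hI _ hl hr)
    (hs y hy.le hy'.le)) (not_le.2 hyY)

/-- A floor that passes through cannot have points of the vertical piece on both sides. The side of
`c` is above it, hence so is `u j`. -/
lemma bot_side_lt (h : S.Openings o u) {j : κ} {c : Rect} (hc : S.IsCell c)
    (hs : ∀ y : ℝ, c.b ≤ y → y ≤ c.t → y ∈ S.J j)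
    (hin : ∀ i, c.b = S.Y i → IsInner (S.I i) (S.X j)) : c.b < u j := by
  rcases hc.bot with hb | ⟨i, hi, hI⟩
  · rw [hb]; exact EReal.bot_lt_coe _
  by_contra hlt
  rw [not_lt, hi] at hlt
  have hYu : u j < S.Y i := lt_of_le_of_ne (by exact_mod_cast hlt) (h.u_ne i j)
  obtain ⟨y, hy, hy'⟩ := Rect.exists_real_between hc.lt_v
  refine S.not_cross i j (hin i hi) ⟨⟨u j, h.u_mem j, hYu⟩, y, hs y hy.le hy'.le, ?_⟩
  rw [hi] at hy; exact_mod_cast hy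

lemma openAt_ne (h : S.Openings o u) {c : Rect} (hc : S.IsCell c) (j : κ) :
    S.openAt o c.b ≠ S.X j := by
  rcases hc.bot with hb | ⟨i, hi, -⟩
  · simp [hb]
  · rw [hi, openAt_Y]; exact_mod_cast h.o_ne i j

end Openings

lemma IsCell.left_side {c : Rect} (hc : S.IsCell c) {j : κ} (hj : c.l = S.X j) :
    ∀ y : ℝ, c.b ≤ y → y ≤ c.t → y ∈ S.J j := by
  rcases hc.left with h | ⟨j', h, h'⟩
  · rw [h] at hj; simp at hj
  · rwa [S.X_inj (EReal.coe_injective (h.symm.trans hj))] at h'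

lemma IsCell.right_side {c : Rect} (hc : S.IsCell c) {j : κ} (hj : c.r = S.X j) :
    ∀ y : ℝ, c.b ≤ y → y ≤ c.t → y ∈ S.J j := by
  rcases hc.right with h | ⟨j', h, h'⟩
  · rw [h] at hj; simp at hj
  · rwa [S.X_inj (EReal.coe_injective (h.symm.trans hj))] at h'

lemma IsCell.bot_side {c : Rect} (hc : S.IsCell c) {i : ι} (hi : c.b = S.Y i) :
    ∀ x : ℝ, c.l ≤ x → x ≤ c.r → x ∈ S.I i :=
  hc.swap.left_side hi

lemma IsCell.eq_of_left {q q' : Rect} (h : S.IsCell q) (h' : S.IsCell q') {y : ℝ}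
    (hy : q.b < y ∧ (y : EReal) < q.t) (hy' : q'.b < y ∧ (y : EReal) < q'.t) (hb : q.l = q'.l) :
    q = q' :=
  congrArg Rect.swap (h.swap.eq_of_bot h'.swap hy hy' hb)

lemma IsCell.eq_of_right {q q' : Rect} (h : S.IsCell q) (h' : S.IsCell q') {y : ℝ}
    (hy : q.b < y ∧ (y : EReal) < q.t) (hy' : q'.b < y ∧ (y : EReal) < q'.t) (hb : q.r = q'.r) :
    q = q' :=
  congrArg Rect.swap (h.swap.eq_of_top h'.swap hy hy' hb)

/-- The opening of the floor is under the cell, left of it or right of it. These cases exclude each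
other, and in each the piece is determined by its line. -/
lemma ParentEdge.unique {v v' : Plane} {c : Rect} (hc : S.IsCell c) (hv : S.ParentEdge o u v c)
    (hv' : S.ParentEdge o u v' c) : v = v' := by
  have hlr := hc.lt_h
  rcases hv with ⟨i, rfl, h1, h2, h3⟩ | ⟨j, rfl, h1, h2⟩ | ⟨j, rfl, h1, h2⟩ <;>
  rcases hv' with ⟨i', rfl, h1', h2', h3'⟩ | ⟨j', rfl, h1', h2'⟩ | ⟨j', rfl, h1', h2'⟩
  · rw [S.Y_inj (EReal.coe_injective (h1.symm.trans h1'))]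
  · rw [h1, openAt_Y, ← h1'] at h2'; exact absurd h2 h2'.not_gt
  · rw [h1, openAt_Y, ← h1'] at h2'; exact absurd h3 h2'.not_gt
  · rw [h1', openAt_Y, ← h1] at h2; exact absurd h2 h2'.not_gt
  · rw [S.X_inj (EReal.coe_injective (h1.symm.trans h1'))]
  · rw [← h1] at h2; rw [← h1'] at h2'; exact absurd (h2.trans hlr) h2'.not_gt
  · rw [h1', openAt_Y, ← h1] at h2; exact absurd h3' h2.not_gt
  · rw [← h1] at h2; rw [← h1'] at h2'; exact absurd (h2'.trans hlr) h2.not_gt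
  · rw [S.X_inj (EReal.coe_injective (h1.symm.trans h1'))]

lemma IsCell.eq_of_root {q q' : Rect} (h : S.IsCell q) (h' : S.IsCell q') (hl : q.l = ⊥)
    (hb : q.b = ⊥) (hl' : q'.l = ⊥) (hb' : q'.b = ⊥) : q = q' := by
  obtain ⟨x, hx⟩ := Rect.exists_real_between (lt_min h.lt_h (by rw [hl, ← hl']; exact h'.lt_h) :
    q.l < min q.r q'.r)
  rw [lt_min_iff] at hx
  exact h.eq_of_bot h' ⟨hx.1, hx.2.1⟩ ⟨by rw [hl', ← hl]; exact hx.1, hx.2.2⟩ (hb.trans hb'.symm)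

variable [Finite ι] [Finite κ]

lemma Openings.exists_isParent_h (h : S.Openings o u) (i : ι) :
    ∃ c p, S.IsCell c ∧ S.IsCell p ∧ S.IsParent o u (o i, S.Y i) c p ∧ c.b = S.Y i ∧
      c.l < o i ∧ (o i : EReal) < c.r := by
  obtain ⟨q, q', hq, hq', h1, h2, h3, h4, -, h6⟩ := exists_cells_h (h.o_mem i) (h.o_ne i)
  refine ⟨q, q', hq, hq', ⟨h6, ?_, Or.inl ⟨i, rfl, h1, h3⟩⟩, h1, h3⟩
  refine Prod.Lex.toLex_lt_toLex.2 (Or.inl ?_)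
  change q'.b < q.b
  rw [h1, ← h2]
  exact hq'.lt_v

/-- Both cells have the same bottom and hence aim at the same opening; the one farther from it is
the child. -/
lemma Openings.exists_cells_u (h : S.Openings o u) (j : κ) :
    ∃ q q', S.IsCell q ∧ S.IsCell q' ∧ q.l = S.X j ∧ q'.r = S.X j ∧ q.b = q'.b ∧
      (q.b < u j ∧ (u j : EReal) < q.t) ∧ (q'.b < u j ∧ (u j : EReal) < q'.t) ∧
      (S.openAt o q.b < S.X j → S.IsParent o u (S.X j, u j) q q') ∧
      ((S.X j : EReal) < S.openAt o q.b → S.IsParent o u (S.X j, u j) q' q) := by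
  obtain ⟨q, q', hq, hq', h1, h2, h3, h4, -, h6⟩ := exists_cells_v (h.u_mem j) (fun i => h.u_ne i j)
  have hb : q.b = q'.b := le_antisymm
    (h.bot_le hq (hq.left_side h1) (hq'.right_side h2) h1.le (h1 ▸ hq.lt_h.le) h3.1 h4.2)
    (h.bot_le hq' (hq'.right_side h2) (hq.left_side h1) (h2 ▸ hq'.lt_h.le) h2.ge h4.1 h3.2)
  refine ⟨q, q', hq, hq', h1, h2, hb, h3, h4, fun ho => ⟨h6, ?_, Or.inr (Or.inl ⟨j, rfl, h1, ho⟩)⟩,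
    fun ho => ⟨fun c hc => (h6 c hc).trans or_comm, ?_, Or.inr (Or.inr ⟨j, rfl, h2, hb ▸ ho⟩)⟩⟩
  -- The bottoms agree, so the counts decide: all pieces counted for `q'` are counted for `q`, and
  -- `j` only for `q`.
  · refine Prod.Lex.toLex_lt_toLex.2 (Or.inr ⟨hb.symm, Set.ncard_lt_ncard ?_ (Set.toFinite _)⟩)
    rw [← hb]
    refine (ssubset_iff_of_subset ?_).2 ⟨j, Or.inl ⟨ho, h1.ge⟩, ?_⟩
    · rintro k (⟨hk, hk'⟩ | ⟨hk, hk'⟩)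
      · exact Or.inl ⟨hk, hk'.trans (by rw [h1, ← h2]; exact hq'.lt_h.le)⟩
      · rw [h2] at hk
        exact absurd (hk.trans_lt hk') ho.not_gt
    · rintro (⟨-, hk'⟩ | ⟨-, hk'⟩)
      · rw [← h2] at hk'; exact absurd hq'.lt_h hk'.not_gt
      · exact absurd ho hk'.not_gt
  · refine Prod.Lex.toLex_lt_toLex.2 (Or.inr ⟨hb, Set.ncard_lt_ncard ?_ (Set.toFinite _)⟩)
    rw [← hb]
    refine (ssubset_iff_of_subset ?_).2 ⟨j, Or.inr ⟨h2.le, ho⟩, ?_⟩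
    · rintro k (⟨hk, hk'⟩ | ⟨hk, hk'⟩)
      · rw [h1] at hk'
        exact absurd (hk.trans_le hk') ho.not_gt
      · refine Or.inr ⟨le_trans ?_ hk, hk'⟩
        rw [h2, ← h1]; exact hq.lt_h.le
    · rintro (⟨hk', -⟩ | ⟨hk', -⟩)
      · exact absurd ho hk'.not_gt
      · rw [← h1] at hk'; exact absurd hq.lt_h hk'.not_gt

lemma Openings.exists_isParent (h : S.Openings o u) {v : Plane} (hv : v ∈ S.openings o u) :
    ∃ c p, S.IsCell c ∧ S.IsCell p ∧ S.IsParent o u v c p := by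
  rcases hv with ⟨i, rfl⟩ | ⟨j, rfl⟩
  · obtain ⟨c, p, hc, hp, hcp, -⟩ := h.exists_isParent_h i
    exact ⟨c, p, hc, hp, hcp⟩
  · obtain ⟨q, q', hq, hq', -, -, -, -, -, h1, h2⟩ := h.exists_cells_u j
    rcases lt_or_gt_of_ne (h.openAt_ne hq j) with hlt | hlt
    · exact ⟨q, q', hq, hq', h1 hlt⟩
    · exact ⟨q', q, hq', hq, h2 hlt⟩

lemma Openings.exists_isParent_of_ne_root (h : S.Openings o u) {c : Rect} (hc : S.IsCell c)
    (hne : ¬ (c.l = ⊥ ∧ c.b = ⊥)) :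
    ∃ v p, v ∈ S.openings o u ∧ S.IsCell p ∧ S.IsParent o u v c p := by
  have hI : ∀ i, c.b = S.Y i → ∃ x ∈ S.I i, c.l < x ∧ (x : EReal) < c.r := fun i hi => by
    obtain ⟨x, hx⟩ := Rect.exists_real_between hc.lt_h
    exact ⟨x, hc.bot_side hi x hx.1.le hx.2.le, hx⟩
  by_cases h1 : c.l ≤ S.openAt o c.b
  · by_cases h2 : S.openAt o c.b < c.r
    · rcases hc.bot with hb | ⟨i, hi, -⟩
      · rw [hb, openAt_bot, le_bot_iff] at h1
        exact absurd ⟨h1, hb⟩ hne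
      · rw [hi, openAt_Y] at h1 h2
        have h1' : c.l < o i := by
          refine lt_of_le_of_ne h1 fun e => ?_
          rcases hc.left with h' | ⟨j, hj, -⟩
          · simp [h'] at e
          · exact h.o_ne i j (by exact_mod_cast e.symm.trans hj)
        obtain ⟨c', p, hc', hp, hcp, hb', hlr⟩ := h.exists_isParent_h i
        rw [← hc.eq_of_bot hc' ⟨h1', h2⟩ hlr (hi.trans hb'.symm)] at hcp
        exact ⟨_, p, Or.inl ⟨i, rfl⟩, hp, hcp⟩
    · rw [not_lt] at h2
      rcases hc.right with hr | ⟨j, hj, hs⟩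
      -- An opening is never at plus infinity, so a cell that has to move right has a right wall.
      · rw [hr, top_le_iff, openAt] at h2
        split_ifs at h2 <;> simp at h2
      · have hlt : (S.X j : EReal) < S.openAt o c.b :=
          lt_of_le_of_ne (hj ▸ h2) (h.openAt_ne hc j).symm
        -- The floor has points of the bottom side to the left of the wall and its opening to the
        -- right, so it passes through.
        have hbu : c.b < u j := h.bot_side_lt hc hs fun i hi => by
          obtain ⟨x, hxI, -, hx⟩ := hI i hi
          rw [hi, openAt_Y] at hlt
          exact ⟨⟨x, hxI, by rw [hj] at hx; exact_mod_cast hx⟩, o i, h.o_mem i,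
            by exact_mod_cast hlt⟩
        have hut := h.lt_top_side hc hs (hj ▸ hc.lt_h.le) hj.ge
        obtain ⟨q, q', hq, hq', -, e2, e3, -, e5, -, e7⟩ := h.exists_cells_u j
        have := hc.eq_of_right hq' ⟨hbu, hut⟩ e5 (hj.trans e2.symm)
        subst this
        exact ⟨_, q, Or.inr ⟨j, rfl⟩, hq, e7 (e3 ▸ hlt)⟩
  · rw [not_le] at h1
    rcases hc.left with hl | ⟨j, hj, hs⟩
    · rw [hl] at h1; exact absurd h1 not_lt_bot
    · have hlt : S.openAt o c.b < S.X j := hj ▸ h1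
      have hbu : c.b < u j := h.bot_side_lt hc hs fun i hi => by
        obtain ⟨x, hxI, hx, -⟩ := hI i hi
        rw [hi, openAt_Y] at hlt
        exact ⟨⟨o i, h.o_mem i, by exact_mod_cast hlt⟩, x, hxI,
          by rw [hj] at hx; exact_mod_cast hx⟩
      have hut := h.lt_top_side hc hs hj.le (hj ▸ hc.lt_h.le)
      obtain ⟨q, q', hq, hq', e1, -, -, e4, -, e6, -⟩ := h.exists_cells_u j
      have := hc.eq_of_left hq ⟨hbu, hut⟩ e4 (hj.trans e1.symm)
      subst this
      exact ⟨_, q', Or.inr ⟨j, rfl⟩, hq', e6 hlt⟩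

/-- Take the cell of a point to the left of all vertical lines and below all horizontal ones. -/
lemma exists_root (S : SegSystem ι κ) : ∃ c, S.IsCell c ∧ c.l = ⊥ ∧ c.b = ⊥ := by
  obtain ⟨x, hx⟩ := (Set.finite_range S.X).bddBelow
  obtain ⟨y, hy⟩ := (Set.finite_range S.Y).bddBelow
  have hX : ∀ j, x - 1 < S.X j := fun j => by linarith [hx (mem_range_self j)]
  have hY : ∀ i, y - 1 < S.Y i := fun i => by linarith [hy (mem_range_self i)]
  have hD : ((x - 1, y - 1) : Plane) ∉ S.D := by
    rintro (⟨i, h, -⟩ | ⟨j, h, -⟩)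
    · exact (hY i).ne h
    · exact (hX j).ne h
  obtain ⟨c, hc, hm⟩ := exists_cell hD
  refine ⟨c, hc, ?_, ?_⟩
  · rcases hc.left with h | ⟨j, h, -⟩
    · exact h
    · have := hm.1.1
      rw [h] at this
      exact absurd (hX j) (not_lt.2 (by exact_mod_cast this.le))
  · rcases hc.bot with h | ⟨j, h, -⟩
    · exact h
    · have := hm.2.1
      rw [h] at this
      exact absurd (hY j) (not_lt.2 (by exact_mod_cast this.le))

/-- The cells of a homeomorphic image of a segment system and the openings form a tree. -/
theorem Openings.multigraphIsTree (h : S.Openings o u) (f : Plane ≃ₜ Plane) {D : Set Plane}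
    (hD : D = f ⁻¹' S.D) (G : Graph (Set Plane) Plane) (hV : G.vertexSet = complCells D)
    (hG : ∀ v x y, G.IsLink v x y ↔ f v ∈ S.openings o u ∧ x ≠ y ∧
      {c | c ∈ complCells D ∧ v ∈ frontier c} = {x, y}) : MultigraphIsTree G := by
  let φ : {q : Rect // S.IsCell q} → Set Plane := fun q => f ⁻¹' q.1.box
  have hφ : Function.Injective φ := fun q q' e => Subtype.ext
    (Rect.box_injective q.2.lt_h q.2.lt_v (f.surjective.preimage_injective e))
  have hcells : complCells D = range φ := by
    rw [hD, complCells_preimage, complCells_D, image_image]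
    ext c
    constructor
    · rintro ⟨q, hq, rfl⟩; exact ⟨⟨q, hq⟩, rfl⟩
    · rintro ⟨q, rfl⟩; exact ⟨q.1, q.2, rfl⟩
  have hstar : ∀ v (c p : {q : Rect // S.IsCell q}), S.IsParent o u (f v) c p →
      {c | c ∈ complCells D ∧ v ∈ frontier c} = {φ c, φ p} := fun v c p hcp => by
    ext d
    rw [mem_ofPred_eq, hcells, mem_insert_iff, mem_singleton_iff]
    have hfr : ∀ q : {q : Rect // S.IsCell q}, v ∈ frontier (φ q) ↔ q = c ∨ q = p := fun q => by
      change v ∈ frontier (f ⁻¹' _) ↔ _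
      rw [← f.preimage_frontier, mem_preimage, hcp.1 q q.2]
      simp [Subtype.ext_iff]
    constructor
    · rintro ⟨⟨q, rfl⟩, hq⟩
      exact ((hfr q).1 hq).imp (congrArg φ) (congrArg φ)
    · rintro (rfl | rfl)
      · exact ⟨mem_range_self _, (hfr c).2 (Or.inl rfl)⟩
      · exact ⟨mem_range_self _, (hfr p).2 (Or.inr rfl)⟩
  have hfin : (S.openings o u).Finite := by
    refine ((Set.finite_range fun i => ((o i, S.Y i) : Plane)).union
      (Set.finite_range fun j => ((S.X j, u j) : Plane))).subset ?_
    rintro v (⟨i, rfl⟩ | ⟨j, rfl⟩)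
    · exact Or.inl ⟨i, rfl⟩
    · exact Or.inr ⟨j, rfl⟩
  obtain ⟨r, hr, hrl, hrb⟩ := S.exists_root
  refine multigraphIsTree_of_parent G φ
    (fun v c p => f v ∈ S.openings o u ∧ S.IsParent o u (f v) c p) (fun q => S.rank o q.1)
    ⟨r, hr⟩ (hfin.preimage f.injective.injOn) (hV.trans hcells) hφ ?_ ?_ ?_ ?_
  · intro v x y hl
    obtain ⟨hv, -, hs⟩ := (hG v x y).1 hl
    obtain ⟨c, p, hc, hp, hcp⟩ := h.exists_isParent hv
    refine ⟨⟨c, hc⟩, ⟨p, hp⟩, ⟨hv, hcp⟩, ?_⟩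
    rw [hstar v ⟨c, hc⟩ ⟨p, hp⟩ hcp, Set.pair_eq_pair_iff] at hs
    rcases hs with ⟨h1, h2⟩ | ⟨h1, h2⟩
    · exact Or.inl ⟨h1.symm, h2.symm⟩
    · exact Or.inr ⟨h2.symm, h1.symm⟩
  · rintro v c p ⟨hv, hcp⟩
    refine ⟨hv, (hG _ _ _).2 ⟨hv, fun e => ?_, hstar v c p hcp⟩, hcp.2.1⟩
    exact absurd hcp.2.1 (by rw [hφ e]; exact lt_irrefl _)
  · rintro v v' c p p' ⟨-, h1⟩ ⟨-, h2⟩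
    exact f.injective (ParentEdge.unique c.2 h1.2.2 h2.2.2)
  · intro c hc
    obtain ⟨v, p, hv, hp, hvp⟩ := h.exists_isParent_of_ne_root c.2 fun e =>
      hc (Subtype.ext (c.2.eq_of_root hr e.1 e.2 hrl hrb))
    exact ⟨f.symm v, ⟨p, hp⟩, by simpa using hv, by simpa using hvp⟩

/-- Every opening is on the boundary of exactly two cells. -/
theorem Openings.exists_pair (h : S.Openings o u) (f : Plane ≃ₜ Plane) {v : Plane}
    (hv : f v ∈ S.openings o u) :
    ∃ x y, x ≠ y ∧ {c | c ∈ complCells (f ⁻¹' S.D) ∧ v ∈ frontier c} = {x, y} := by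
  obtain ⟨c, p, hc, hp, hcp⟩ := h.exists_isParent hv
  refine ⟨f ⁻¹' c.box, f ⁻¹' p.box, fun e => ?_, ?_⟩
  · exact absurd hcp.2.1 (by
      rw [Rect.box_injective hc.lt_h hc.lt_v (f.surjective.preimage_injective e)]
      exact lt_irrefl _)
  · ext d
    rw [mem_ofPred_eq, complCells_preimage, complCells_D, mem_insert_iff, mem_singleton_iff]
    constructor
    · rintro ⟨⟨_, ⟨q, hq, rfl⟩, rfl⟩, hd⟩
      rw [← f.preimage_frontier, mem_preimage, hcp.1 q hq] at hd
      rcases hd with rfl | rfl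
      · exact Or.inl rfl
      · exact Or.inr rfl
    · rintro (rfl | rfl)
      · exact ⟨⟨_, ⟨c, hc, rfl⟩, rfl⟩,
          by rw [← f.preimage_frontier]; exact (hcp.1 c hc).2 (Or.inl rfl)⟩
      · exact ⟨⟨_, ⟨p, hp, rfl⟩, rfl⟩,
          by rw [← f.preimage_frontier]; exact (hcp.1 p hp).2 (Or.inr rfl)⟩

end SegSystem

/-! ### Intervals extended up to the nearest obstacles -/

/-- The interval obtained by extending `[p, q]` in both directions up to the first point of `F`. -/
def extendInterval (p q : ℝ) (F : Set ℝ) : Set ℝ :=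
  {x | ∀ f ∈ F, (q ≤ f → x ≤ f) ∧ (f ≤ p → f ≤ x)}

section extendInterval

variable {p q : ℝ} {F : Set ℝ}

lemma ordConnected_extendInterval : (extendInterval p q F).OrdConnected :=
  ⟨fun _ hx _ hy _ hz f hf => ⟨fun h => hz.2.trans ((hy f hf).1 h), fun h => ((hx f hf).2 h).trans hz.1⟩⟩

lemma mem_extendInterval_of_mem_Icc {x : ℝ} (hp : p ≤ x) (hq : x ≤ q) :
    x ∈ extendInterval p q F := fun _ _ => ⟨fun h => hq.trans h, fun h => h.trans hp⟩

/-- The end is the least obstacle that is at least `q`, or the greatest that is at most `p`. -/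
lemma exists_end_extendInterval (hF : F.Finite) {x x' : ℝ} (hpq : p < q)
    (hx : x ∈ extendInterval p q F)
    (hx' : x' ∉ extendInterval p q F) : ∃ e ∈ F, e ∈ uIcc x x' ∧ e ∈ extendInterval p q F := by
  simp only [extendInterval, mem_ofPred_eq, not_forall] at hx'
  obtain ⟨f, hf, h⟩ := hx'
  rw [not_and_or] at h
  push Not at h
  rcases h with ⟨h1, h2⟩ | ⟨h1, h2⟩
  · obtain ⟨m, ⟨hm, hqm⟩, hmin⟩ := Set.exists_min_image (F ∩ Ici q) id (hF.inter_of_left _) ⟨f, hf, h1⟩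
    have hmf : m ≤ f := hmin f ⟨hf, h1⟩
    rw [mem_Ici] at hqm
    refine ⟨m, hm, mem_uIcc.2 (Or.inl ⟨(hx m hm).1 hqm, (hmf.trans_lt h2).le⟩), fun g hg =>
      ⟨fun h => hmin g ⟨hg, h⟩, fun h => by linarith⟩⟩
  · obtain ⟨m, ⟨hm, hqm⟩, hmax⟩ := Set.exists_max_image (F ∩ Iic p) id (hF.inter_of_left _) ⟨f, hf, h1⟩
    have hmf : f ≤ m := hmax f ⟨hf, h1⟩
    rw [mem_Iic] at hqm
    refine ⟨m, hm, mem_uIcc.2 (Or.inr ⟨(h2.trans_le hmf).le, (hx m hm).2 hqm⟩), fun g hg =>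
      ⟨fun h => by linarith, fun h => hmax g ⟨hg, h⟩⟩⟩

lemma isInner_extendInterval (hF : F.Finite) {x : ℝ} (hx : x ∈ extendInterval p q F) (hxF : x ∉ F) :
    IsInner (extendInterval p q F) x := by
  constructor
  · obtain ⟨l, hl, hlF, -⟩ := exists_ereal_left hF hxF
    obtain ⟨w, hw, hw'⟩ := Rect.exists_real_between hl
    have hwx : w < x := by exact_mod_cast hw'
    refine ⟨w, fun f hf => ⟨fun h => hwx.le.trans ((hx f hf).1 h), fun h => ?_⟩, hwx⟩
    by_contra hlt
    exact absurd ((hx f hf).2 h)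
      (not_le.2 (hlF f hf (hw.trans (by exact_mod_cast not_le.1 hlt))))
  · obtain ⟨l, hl, hlF, -⟩ := exists_ereal_right hF hxF
    obtain ⟨w, hw', hw⟩ := Rect.exists_real_between hl
    have hwx : x < w := by exact_mod_cast hw'
    refine ⟨w, fun f hf => ⟨fun h => ?_, fun h => ((hx f hf).2 h).trans hwx.le⟩, hwx⟩
    by_contra hlt
    exact absurd ((hx f hf).1 h)
      (not_le.2 (hlF f hf (lt_trans (by exact_mod_cast not_le.1 hlt) hw)))

lemma not_isInner_of_mem {f : ℝ} (hf : f ∈ F) (hfpq : f ≤ p ∨ q ≤ f) :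
    ¬ IsInner (extendInterval p q F) f := by
  rintro ⟨⟨u, hu, huf⟩, w, hw, hfw⟩
  rcases hfpq with h | h
  · exact absurd ((hu f hf).2 h) (not_le.2 huf)
  · exact absurd ((hw f hf).1 h) (not_le.2 hfw)

lemma neg_mem_extendInterval {x : ℝ} {F' : Set ℝ} (h : ∀ f, f ∈ F' ↔ -f ∈ F) :
    x ∈ extendInterval (-q) (-p) F' ↔ -x ∈ extendInterval p q F := by
  constructor
  · intro hx f hf
    have := hx (-f) ((h _).2 (by simpa using hf))
    exact ⟨fun h => by linarith [this.2 (by linarith)], fun h => by linarith [this.1 (by linarith)]⟩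
  · intro hx f hf
    have := hx (-f) ((h _).1 hf)
    exact ⟨fun h => by linarith [this.2 (by linarith)], fun h => by linarith [this.1 (by linarith)]⟩

end extendInterval

/-! ### Extending the horizontal segments before the vertical ones -/

/-- Disjoint horizontal and vertical segments in general position. -/
structure SegFamily (ι κ : Type*) where
  /-- heights of the horizontal segments -/
  Y : ι → ℝ
  /-- left ends -/
  xl : ι → ℝ
  /-- right ends -/
  xr : ι → ℝ
  /-- abscissas of the vertical segments -/
  X : κ → ℝ
  /-- bottom ends -/
  yb : κ → ℝ
  /-- top ends -/
  yt : κ → ℝ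
  xl_lt : ∀ i, xl i < xr i
  yb_lt : ∀ j, yb j < yt j
  Y_inj : Function.Injective Y
  X_inj : Function.Injective X
  xl_ne : ∀ i j, xl i ≠ X j
  xr_ne : ∀ i j, xr i ≠ X j
  yb_ne : ∀ i j, yb j ≠ Y i
  yt_ne : ∀ i j, yt j ≠ Y i
  disj : ∀ i j, xl i ≤ X j → X j ≤ xr i → yb j ≤ Y i → Y i ≤ yt j → False

namespace SegFamily

variable {ι κ : Type*} (A : SegFamily ι κ)

/-- The abscissas at which vertical segments block the horizontal line through segment `i`. -/
def hObst (i : ι) : Set ℝ := {x | ∃ j, x = A.X j ∧ A.yb j ≤ A.Y i ∧ A.Y i ≤ A.yt j}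

/-- The extension of a horizontal segment. -/
def hExt (i : ι) : Set ℝ := extendInterval (A.xl i) (A.xr i) (A.hObst i)

/-- The heights at which extended horizontal segments block the extension of the vertical segment
`j`. -/
def vObst (j : κ) : Set ℝ := {y | (∃ i, y = A.Y i ∧ A.X j ∈ A.hExt i) ∧ ¬ (A.yb j ≤ y ∧ y ≤ A.yt j)}

/-- The extension of a vertical segment, after all horizontal segments. -/
def vExt (j : κ) : Set ℝ := extendInterval (A.yb j) (A.yt j) (A.vObst j)

lemma hObst_finite [Finite κ] (i : ι) : (A.hObst i).Finite :=
  (Set.finite_range A.X).subset fun _ ⟨j, h, _⟩ => ⟨j, h.symm⟩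

lemma vObst_finite [Finite ι] (j : κ) : (A.vObst j).Finite :=
  (Set.finite_range A.Y).subset fun _ ⟨⟨i, h, _⟩, _⟩ => ⟨i, h.symm⟩

lemma X_notMem_hObst {i : ι} {j : κ} (h : ¬ (A.yb j ≤ A.Y i ∧ A.Y i ≤ A.yt j)) :
    A.X j ∉ A.hObst i := by
  rintro ⟨j', hj, h'⟩
  exact h (A.X_inj hj ▸ h')

/-- Horizontal extensions are stopped only by vertical segments, not by their extensions. This is
where the order of the two directions enters. -/
lemma isInner_hExt [Finite κ] {i : ι} {j : κ} (h : ¬ (A.yb j ≤ A.Y i ∧ A.Y i ≤ A.yt j))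
    (hX : A.X j ∈ A.hExt i) : IsInner (A.hExt i) (A.X j) :=
  isInner_extendInterval (A.hObst_finite i) hX (A.X_notMem_hObst h)

/-- The segment system formed by the extended segments. -/
def system [Finite ι] [Finite κ] : SegSystem ι κ where
  Y := A.Y
  I := A.hExt
  X := A.X
  J := A.vExt
  Y_inj := A.Y_inj
  X_inj := A.X_inj
  I_conn _ := ordConnected_extendInterval
  J_conn _ := ordConnected_extendInterval
  end_h i x x' hx hx' := by
    obtain ⟨_, ⟨j, rfl, h1, h2⟩, he, he'⟩ :=
      exists_end_extendInterval (A.hObst_finite i) (A.xl_lt i) hx hx'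
    refine ⟨j, he, he', ⟨A.yb j, ?_, lt_of_le_of_ne h1 (A.yb_ne i j)⟩, A.yt j, ?_,
      lt_of_le_of_ne h2 (A.yt_ne i j).symm⟩
    · exact mem_extendInterval_of_mem_Icc le_rfl (A.yb_lt j).le
    · exact mem_extendInterval_of_mem_Icc (A.yb_lt j).le le_rfl
  end_v j y y' hy hy' := by
    obtain ⟨_, ⟨⟨i, rfl, hX⟩, h⟩, he, he'⟩ :=
      exists_end_extendInterval (A.vObst_finite j) (A.yb_lt j) hy hy'
    -- `vObst` omits heights on segment `j` itself, so the blocking horizontal piece meets the line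
    -- off the segment and passes through.
    exact ⟨i, he, he', A.isInner_hExt h hX⟩
  not_cross i j hX hY := by
    have hXm : A.X j ∈ A.hExt i := by
      obtain ⟨⟨u, hu, hux⟩, w, hw, hxw⟩ := hX
      exact ordConnected_extendInterval.out hu hw ⟨hux.le, hxw.le⟩
    -- On segment `j`, the segment stops piece `i`, since disjointness puts the meeting point
    -- outside segment `i`. Off segment `j`, piece `i` stops piece `j`.
    by_cases h : A.yb j ≤ A.Y i ∧ A.Y i ≤ A.yt j
    · refine not_isInner_of_mem (F := A.hObst i) ⟨j, rfl, h⟩ ?_ hX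
      by_contra! h'
      exact A.disj i j h'.1.le h'.2.le h.1 h.2
    · refine not_isInner_of_mem (F := A.vObst j) ⟨⟨i, rfl, hXm⟩, h⟩ ?_ hY
      by_contra! h'
      exact h ⟨h'.1.le, h'.2.le⟩

lemma openings_system [Finite ι] [Finite κ] : A.system.Openings A.xl A.yb where
  o_mem i := mem_extendInterval_of_mem_Icc le_rfl (A.xl_lt i).le
  u_mem j := mem_extendInterval_of_mem_Icc le_rfl (A.yb_lt j).le
  o_ne := A.xl_ne
  u_ne i j := A.yb_ne i j
  free _ _ _ h hX := A.isInner_hExt (fun h' => absurd h'.1 (not_le.2 h)) hX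

/-- Reflection in the origin. -/
def neg : SegFamily ι κ where
  Y i := -A.Y i
  xl i := -A.xr i
  xr i := -A.xl i
  X j := -A.X j
  yb j := -A.yt j
  yt j := -A.yb j
  xl_lt i := neg_lt_neg (A.xl_lt i)
  yb_lt j := neg_lt_neg (A.yb_lt j)
  Y_inj _ _ h := A.Y_inj (neg_injective h)
  X_inj _ _ h := A.X_inj (neg_injective h)
  xl_ne i j h := A.xr_ne i j (neg_injective h)
  xr_ne i j h := A.xl_ne i j (neg_injective h)
  yb_ne i j h := A.yt_ne i j (neg_injective h)
  yt_ne i j h := A.yb_ne i j (neg_injective h)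
  disj i j h1 h2 h3 h4 := A.disj i j (neg_le_neg_iff.1 h2) (neg_le_neg_iff.1 h1)
    (neg_le_neg_iff.1 h4) (neg_le_neg_iff.1 h3)

lemma mem_hExt_neg {i : ι} {x : ℝ} : x ∈ A.neg.hExt i ↔ -x ∈ A.hExt i := by
  refine neg_mem_extendInterval fun f => ?_
  simp only [hObst, mem_ofPred_eq, neg, neg_le_neg_iff]
  exact exists_congr fun j => and_congr neg_eq_iff_eq_neg.symm and_comm

lemma mem_vExt_neg {j : κ} {y : ℝ} : y ∈ A.neg.vExt j ↔ -y ∈ A.vExt j := by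
  refine neg_mem_extendInterval fun f => ?_
  simp only [vObst, mem_ofPred_eq, A.mem_hExt_neg]
  refine and_congr (exists_congr fun i => and_congr neg_eq_iff_eq_neg.symm ?_) (not_congr ?_)
  · simp [neg]
  · simp only [neg]
    rw [and_comm]
    exact and_congr le_neg neg_le

lemma neg_system_D [Finite ι] [Finite κ] : A.system.D = Homeomorph.neg Plane ⁻¹' A.neg.system.D := by
  ext p
  simp only [SegSystem.D, mem_preimage, mem_ofPred_eq, Homeomorph.coe_neg]
  refine or_congr (exists_congr fun i => ?_) (exists_congr fun j => ?_)
  · change p.2 = A.Y i ∧ p.1 ∈ A.hExt i ↔ -p.2 = -A.Y i ∧ -p.1 ∈ A.neg.hExt i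
    rw [mem_hExt_neg, neg_neg, neg_inj]
  · change p.1 = A.X j ∧ p.2 ∈ A.vExt j ↔ -p.1 = -A.X j ∧ -p.2 ∈ A.neg.vExt j
    rw [mem_vExt_neg, neg_neg, neg_inj]

end SegFamily

/-! ### Coordinates and general position of axis-parallel segments -/

/-- Least abscissa of the ends. -/
noncomputable def xmin : Sym2 Plane → ℝ :=
  Sym2.lift ⟨fun a b => min a.1 b.1, fun _ _ => min_comm _ _⟩

/-- Greatest abscissa of the ends. -/
noncomputable def xmax : Sym2 Plane → ℝ :=
  Sym2.lift ⟨fun a b => max a.1 b.1, fun _ _ => max_comm _ _⟩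

/-- Least ordinate of the ends. -/
noncomputable def ymin : Sym2 Plane → ℝ :=
  Sym2.lift ⟨fun a b => min a.2 b.2, fun _ _ => min_comm _ _⟩

/-- Greatest ordinate of the ends. -/
noncomputable def ymax : Sym2 Plane → ℝ :=
  Sym2.lift ⟨fun a b => max a.2 b.2, fun _ _ => max_comm _ _⟩

@[simp] lemma xmin_mk (a b : Plane) : xmin s(a, b) = min a.1 b.1 := rfl
@[simp] lemma xmax_mk (a b : Plane) : xmax s(a, b) = max a.1 b.1 := rfl
@[simp] lemma ymin_mk (a b : Plane) : ymin s(a, b) = min a.2 b.2 := rfl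
@[simp] lemma ymax_mk (a b : Plane) : ymax s(a, b) = max a.2 b.2 := rfl

lemma IsHorizontal.eq_mk {e : Sym2 Plane} (h : IsHorizontal e) (hd : ¬ e.IsDiag) :
    e = s((xmin e, ymin e), (xmax e, ymin e)) ∧ xmin e < xmax e := by
  induction e using Sym2.ind with
  | _ a b =>
    obtain ⟨a1, a2⟩ := a
    obtain ⟨b1, b2⟩ := b
    have h2 : a2 = b2 := h _ (Sym2.mem_mk_left _ _) _ (Sym2.mem_mk_right _ _)
    subst h2
    have h1 : a1 ≠ b1 := fun e => hd (by simp [e])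
    rcases lt_or_gt_of_ne h1 with h' | h'
    · simp [h'.le, h']
    · simp [h'.le, h', Sym2.eq_swap]

lemma IsVertical.eq_mk {e : Sym2 Plane} (h : IsVertical e) (hd : ¬ e.IsDiag) :
    e = s((xmin e, ymin e), (xmin e, ymax e)) ∧ ymin e < ymax e := by
  induction e using Sym2.ind with
  | _ a b =>
    obtain ⟨a1, a2⟩ := a
    obtain ⟨b1, b2⟩ := b
    have h2 : a1 = b1 := h _ (Sym2.mem_mk_left _ _) _ (Sym2.mem_mk_right _ _)
    subst h2
    have h1 : a2 ≠ b2 := fun e => hd (by simp [e])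
    rcases lt_or_gt_of_ne h1 with h' | h'
    · simp [h'.le, h']
    · simp [h'.le, h', Sym2.eq_swap]

lemma closedSeg_mk (a b : Plane) : closedSeg s(a, b) = segment ℝ a b := by
  unfold closedSeg
  rw [← convexHull_pair]
  congr 1
  ext x
  simp

lemma mem_closedSeg_h {e : Sym2 Plane} (h : IsHorizontal e) (hd : ¬ e.IsDiag) {p : Plane} :
    p ∈ closedSeg e ↔ p.2 = ymin e ∧ xmin e ≤ p.1 ∧ p.1 ≤ xmax e := by
  obtain ⟨he, hlt⟩ := h.eq_mk hd
  nth_rewrite 1 [he]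
  rw [closedSeg_mk, ← Prod.image_mk_segment_left, segment_eq_Icc hlt.le]
  obtain ⟨x, y⟩ := p
  simp only [mem_image, mem_Icc, Prod.mk.injEq]
  constructor
  · rintro ⟨z, hz, rfl, rfl⟩; exact ⟨rfl, hz⟩
  · rintro ⟨rfl, hz⟩; exact ⟨x, hz, rfl, rfl⟩

lemma mem_closedSeg_v {e : Sym2 Plane} (h : IsVertical e) (hd : ¬ e.IsDiag) {p : Plane} :
    p ∈ closedSeg e ↔ p.1 = xmin e ∧ ymin e ≤ p.2 ∧ p.2 ≤ ymax e := by
  obtain ⟨he, hlt⟩ := h.eq_mk hd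
  nth_rewrite 1 [he]
  rw [closedSeg_mk, ← Prod.image_mk_segment_right, segment_eq_Icc hlt.le]
  obtain ⟨x, y⟩ := p
  simp only [mem_image, mem_Icc, Prod.mk.injEq]
  constructor
  · rintro ⟨z, hz, rfl, rfl⟩; exact ⟨rfl, hz⟩
  · rintro ⟨rfl, hz⟩; exact ⟨y, hz, rfl, rfl⟩

lemma collinear_of_snd_eq {a b c : Plane} (h : a.2 = b.2) (h' : c.2 = a.2) :
    Collinear ℝ {a, b, c} := by
  rw [collinear_iff_exists_forall_eq_smul_vadd]
  refine ⟨a, (1, 0), ?_⟩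
  rintro p (rfl | rfl | rfl)
  · exact ⟨0, by simp⟩
  · exact ⟨p.1 - a.1, by ext <;> simp [h]⟩
  · exact ⟨p.1 - a.1, by ext <;> simp [h']⟩

lemma collinear_of_fst_eq {a b c : Plane} (h : a.1 = b.1) (h' : c.1 = a.1) :
    Collinear ℝ {a, b, c} := by
  rw [collinear_iff_exists_forall_eq_smul_vadd]
  refine ⟨a, (0, 1), ?_⟩
  rintro p (rfl | rfl | rfl)
  · exact ⟨0, by simp⟩
  · exact ⟨p.2 - a.2, by ext <;> simp [h]⟩
  · exact ⟨p.2 - a.2, by ext <;> simp [h']⟩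

namespace PerfectMatching

variable {M : PerfectMatching}

lemma eq_of_mem_mem {e f : Sym2 Plane} (he : e ∈ M.edges) (hf : f ∈ M.edges) {v : Plane}
    (hve : v ∈ e) (hvf : v ∈ f) : e = f :=
  (M.degree_one v (M.mem_verts e he v hve)).unique ⟨he, hve⟩ ⟨hf, hvf⟩

lemma left_mem {e : Sym2 Plane} (he : e ∈ M.edges) (hh : IsHorizontal e) :
    ((xmin e, ymin e) : Plane) ∈ e := by
  have h1 := (hh.eq_mk (M.not_isDiag e he)).1
  have h2 := Sym2.mem_mk_left ((xmin e, ymin e) : Plane) ((xmax e, ymin e))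
  rwa [← h1] at h2

lemma right_mem {e : Sym2 Plane} (he : e ∈ M.edges) (hh : IsHorizontal e) :
    ((xmax e, ymin e) : Plane) ∈ e := by
  have h1 := (hh.eq_mk (M.not_isDiag e he)).1
  have h2 := Sym2.mem_mk_right ((xmin e, ymin e) : Plane) ((xmax e, ymin e))
  rwa [← h1] at h2

lemma bottom_mem {e : Sym2 Plane} (he : e ∈ M.edges) (hh : IsVertical e) :
    ((xmin e, ymin e) : Plane) ∈ e := by
  have h1 := (hh.eq_mk (M.not_isDiag e he)).1
  have h2 := Sym2.mem_mk_left ((xmin e, ymin e) : Plane) ((xmin e, ymax e))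
  rwa [← h1] at h2

lemma top_mem {e : Sym2 Plane} (he : e ∈ M.edges) (hh : IsVertical e) :
    ((xmin e, ymax e) : Plane) ∈ e := by
  have h1 := (hh.eq_mk (M.not_isDiag e he)).1
  have h2 := Sym2.mem_mk_right ((xmin e, ymin e) : Plane) ((xmin e, ymax e))
  rwa [← h1] at h2

lemma not_h_and_v {e : Sym2 Plane} (he : e ∈ M.edges) (hh : IsHorizontal e) (hv : IsVertical e) :
    False :=
  (hh.eq_mk (M.not_isDiag e he)).2.ne (hv _ (left_mem he hh) _ (right_mem he hh))

/-- No other vertex lies on the line of a horizontal segment. -/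
lemma eq_of_h_of_mem {e f : Sym2 Plane} (he : e ∈ M.edges) (hh : IsHorizontal e) (hf : f ∈ M.edges)
    {v : Plane} (hv : v ∈ f) (hy : v.2 = ymin e) : e = f := by
  by_contra hne
  refine M.general_position _ (M.mem_verts e he _ (left_mem he hh)) _
    (M.mem_verts e he _ (right_mem he hh)) v (M.mem_verts f hf v hv) ?_ ?_ ?_
    (collinear_of_snd_eq rfl hy)
  · intro h
    exact (hh.eq_mk (M.not_isDiag e he)).2.ne (congrArg Prod.fst h)
  · rintro rfl; exact hne (eq_of_mem_mem he hf (right_mem he hh) hv)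
  · rintro rfl; exact hne (eq_of_mem_mem he hf (left_mem he hh) hv)

/-- No other vertex lies on the line of a vertical segment. -/
lemma eq_of_v_of_mem {e f : Sym2 Plane} (he : e ∈ M.edges) (hh : IsVertical e) (hf : f ∈ M.edges)
    {v : Plane} (hv : v ∈ f) (hy : v.1 = xmin e) : e = f := by
  by_contra hne
  refine M.general_position _ (M.mem_verts e he _ (bottom_mem he hh)) _
    (M.mem_verts e he _ (top_mem he hh)) v (M.mem_verts f hf v hv) ?_ ?_ ?_
    (collinear_of_fst_eq rfl hy)
  · intro h
    exact (hh.eq_mk (M.not_isDiag e he)).2.ne (congrArg Prod.snd h)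
  · rintro rfl; exact hne (eq_of_mem_mem he hf (top_mem he hh) hv)
  · rintro rfl; exact hne (eq_of_mem_mem he hf (bottom_mem he hh) hv)

/-! ### The segment family of a matching and its rays -/

variable (M)

/-- The horizontal segments. -/
abbrev HEdge : Type := {e : Sym2 Plane // e ∈ M.edges ∧ IsHorizontal e}

/-- The vertical segments. -/
abbrev VEdge : Type := {e : Sym2 Plane // e ∈ M.edges ∧ IsVertical e}

instance : Finite M.HEdge :=
  (M.edges.finite_toSet.subset fun _ h => h.1 : {e | e ∈ M.edges ∧ IsHorizontal e}.Finite)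

instance : Finite M.VEdge :=
  (M.edges.finite_toSet.subset fun _ h => h.1 : {e | e ∈ M.edges ∧ IsVertical e}.Finite)

/-- The horizontal and vertical segments of a perfect matching. -/
noncomputable def segFamily : SegFamily M.HEdge M.VEdge where
  Y e := ymin e.1
  xl e := xmin e.1
  xr e := xmax e.1
  X e := xmin e.1
  yb e := ymin e.1
  yt e := ymax e.1
  xl_lt e := (e.2.2.eq_mk (M.not_isDiag _ e.2.1)).2
  yb_lt e := (e.2.2.eq_mk (M.not_isDiag _ e.2.1)).2
  Y_inj e f h := Subtype.ext (eq_of_h_of_mem e.2.1 e.2.2 f.2.1 (left_mem f.2.1 f.2.2) h.symm)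
  X_inj e f h := Subtype.ext (eq_of_v_of_mem e.2.1 e.2.2 f.2.1 (bottom_mem f.2.1 f.2.2) h.symm)
  xl_ne e f h := not_h_and_v e.2.1 e.2.2
    (eq_of_v_of_mem f.2.1 f.2.2 e.2.1 (left_mem e.2.1 e.2.2) h ▸ f.2.2)
  xr_ne e f h := not_h_and_v e.2.1 e.2.2
    (eq_of_v_of_mem f.2.1 f.2.2 e.2.1 (right_mem e.2.1 e.2.2) h ▸ f.2.2)
  yb_ne e f h := not_h_and_v e.2.1 e.2.2
    (eq_of_h_of_mem e.2.1 e.2.2 f.2.1 (bottom_mem f.2.1 f.2.2) h ▸ f.2.2)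
  yt_ne e f h := not_h_and_v e.2.1 e.2.2
    (eq_of_h_of_mem e.2.1 e.2.2 f.2.1 (top_mem f.2.1 f.2.2) h ▸ f.2.2)
  disj e f h1 h2 h3 h4 := by
    have hne : e.1 ≠ f.1 := fun h => not_h_and_v e.2.1 e.2.2 (h ▸ f.2.2)
    -- A meeting point would be a common endpoint of two different edges, against degree one.
    obtain ⟨h5, h6⟩ := M.non_crossing e.1 e.2.1 f.1 f.2.1 hne (xmin f.1, ymin e.1)
      ((mem_closedSeg_h e.2.2 (M.not_isDiag _ e.2.1)).2 ⟨rfl, h1, h2⟩)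
      ((mem_closedSeg_v f.2.2 (M.not_isDiag _ f.2.1)).2 ⟨rfl, h3, h4⟩)
    exact hne (eq_of_mem_mem e.2.1 f.2.1 h5 h6)

/-- Rays are parametrised in units of their own segment; dividing by `q - p` converts positions on
the line into ray parameters. -/
lemma newRays_line {c d : Plane} {p q : ℝ} (hpq : p < q) (P : Set Plane) :
    M.newRays P s(c + p • d, c + q • d) = (fun s : ℝ => c + s • d) '' {x |
      (q ≤ x ∧ ∀ f, c + f • d ∈ M.obstacles P s(c + p • d, c + q • d) → q ≤ f → x ≤ f) ∨
      (x ≤ p ∧ ∀ f, c + f • d ∈ M.obstacles P s(c + p • d, c + q • d) → f ≤ p → f ≤ x)} := by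
  generalize hO : M.obstacles P s(c + p • d, c + q • d) = O
  have hmv : ∀ a b t : ℝ, (c + a • d) + t • ((c + a • d) - (c + b • d)) = c + (a + t * (a - b)) • d :=
    fun a b t => by module
  have hqp : 0 < q - p := sub_pos.2 hpq
  ext x
  constructor
  · rintro ⟨v, w, he, t, ht, rfl, hu⟩
    rw [hO] at hu
    rcases Sym2.eq_iff.1 he with ⟨rfl, rfl⟩ | ⟨rfl, rfl⟩
    · refine ⟨p + t * (p - q), Or.inr ⟨by nlinarith, fun f hf hfp => ?_⟩, (hmv p q t).symm⟩
      by_contra! hlt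
      refine hu ((p - f) / (q - p)) (div_nonneg (by linarith) hqp.le) ?_ ?_
      · rw [div_lt_iff₀ hqp]; linarith
      · rw [hmv]
        convert hf using 3
        field_simp
        ring
    · refine ⟨q + t * (q - p), Or.inl ⟨by nlinarith, fun f hf hfp => ?_⟩, (hmv q p t).symm⟩
      by_contra! hlt
      refine hu ((f - q) / (q - p)) (div_nonneg (by linarith) hqp.le) ?_ ?_
      · rw [div_lt_iff₀ hqp]; linarith
      · rw [hmv]
        convert hf using 3
        field_simp
        ring
  · rintro ⟨x, ⟨hx, hf⟩ | ⟨hx, hf⟩, rfl⟩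
    · refine ⟨c + q • d, c + p • d, Sym2.eq_swap, (x - q) / (q - p),
        div_nonneg (by linarith) hqp.le, ?_, fun u hu hlt => ?_⟩
      · rw [hmv]
        congr 2
        field_simp
        ring
      · rw [hO, hmv]
        intro hm
        rw [lt_div_iff₀ hqp] at hlt
        linarith [hf _ hm (by nlinarith)]
    · refine ⟨c + p • d, c + q • d, rfl, (p - x) / (q - p),
        div_nonneg (by linarith) hqp.le, ?_, fun u hu hlt => ?_⟩
      · rw [hmv]
        congr 2
        field_simp
        ring
      · rw [hO, hmv]
        intro hm
        rw [lt_div_iff₀ hqp] at hlt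
        linarith [hf _ hm (by nlinarith)]

lemma mem_newRays_h {e : Sym2 Plane} (h : IsHorizontal e) (hd : ¬ e.IsDiag) (P : Set Plane)
    {x : Plane} : x ∈ M.newRays P e ↔ x.2 = ymin e ∧
      ((xmax e ≤ x.1 ∧ ∀ f, (f, ymin e) ∈ M.obstacles P e → xmax e ≤ f → x.1 ≤ f) ∨
      (x.1 ≤ xmin e ∧ ∀ f, (f, ymin e) ∈ M.obstacles P e → f ≤ xmin e → f ≤ x.1)) := by
  obtain ⟨he, hlt⟩ := h.eq_mk hd
  have key := M.newRays_line (c := (0, ymin e)) (d := (1, 0)) hlt P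
  have hs : ∀ s : ℝ, ((0, ymin e) : Plane) + s • ((1, 0) : Plane) = (s, ymin e) := fun s => by
    ext <;> simp
  simp only [hs, ← he] at key
  rw [key]
  obtain ⟨x, y⟩ := x
  simp only [mem_image, Prod.mk.injEq, mem_ofPred_eq]
  constructor
  · rintro ⟨z, hz, rfl, rfl⟩; exact ⟨rfl, hz⟩
  · rintro ⟨rfl, hz⟩; exact ⟨x, hz, rfl, rfl⟩

lemma mem_newRays_v {e : Sym2 Plane} (h : IsVertical e) (hd : ¬ e.IsDiag) (P : Set Plane)
    {x : Plane} : x ∈ M.newRays P e ↔ x.1 = xmin e ∧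
      ((ymax e ≤ x.2 ∧ ∀ f, (xmin e, f) ∈ M.obstacles P e → ymax e ≤ f → x.2 ≤ f) ∨
      (x.2 ≤ ymin e ∧ ∀ f, (xmin e, f) ∈ M.obstacles P e → f ≤ ymin e → f ≤ x.2)) := by
  obtain ⟨he, hlt⟩ := h.eq_mk hd
  have key := M.newRays_line (c := (xmin e, 0)) (d := (0, 1)) hlt P
  have hs : ∀ s : ℝ, ((xmin e, 0) : Plane) + s • ((0, 1) : Plane) = (xmin e, s) := fun s => by
    ext <;> simp
  simp only [hs, ← he] at key
  rw [key]
  obtain ⟨x, y⟩ := x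
  simp only [mem_image, Prod.mk.injEq, mem_ofPred_eq]
  constructor
  · rintro ⟨z, hz, rfl, rfl⟩; exact ⟨rfl, hz⟩
  · rintro ⟨rfl, hz⟩; exact ⟨y, hz, rfl, rfl⟩

lemma mem_obstacles {P : Set Plane} {e : Sym2 Plane} {x : Plane} : x ∈ M.obstacles P e ↔
    (∃ f ∈ M.edges, f ≠ e ∧ x ∈ closedSeg f) ∨ x ∈ P := by
  simp only [obstacles, mem_union, mem_iUnion, exists_prop]

/-- Extending segments on disjoint lines does not depend on the order. -/
lemma foldl_newRays (L : Sym2 Plane → Set Plane) (P₀ : Set Plane) (l : List (Sym2 Plane))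
    (hl : l.Nodup) (hsub : ∀ e ∈ l, ∀ P, M.newRays P e ⊆ L e)
    (hcongr : ∀ e ∈ l, ∀ P P', (∀ x ∈ L e, x ∈ P ↔ x ∈ P') → M.newRays P e = M.newRays P' e)
    (hdisj : ∀ e ∈ l, ∀ f ∈ l, e ≠ f → Disjoint (L e) (L f)) :
    l.foldl (fun prev e => prev ∪ M.newRays prev e) P₀ = P₀ ∪ ⋃ e ∈ l, M.newRays P₀ e := by
  induction l using List.reverseRecOn with
  | nil => simp
  | append_singleton l e ih =>
    have hsubl : ∀ f ∈ l, f ∈ l ++ [e] := fun f hf => List.mem_append_left _ hf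
    have hel : e ∈ l ++ [e] := by simp
    rw [List.nodup_append] at hl
    rw [List.foldl_append, ih hl.1 (fun f hf => hsub f (hsubl f hf))
      (fun f hf => hcongr f (hsubl f hf)) fun f hf g hg => hdisj f (hsubl f hf) g (hsubl g hg)]
    simp only [List.foldl_cons, List.foldl_nil]
    -- The earlier rays of this round avoid `L e`, so `e` meets the same obstacles as at the start.
    rw [hcongr e hel (P₀ ∪ ⋃ f ∈ l, M.newRays P₀ f) P₀]
    · ext x
      simp only [mem_union, mem_iUnion, List.mem_append, List.mem_singleton, exists_prop, or_and_right,
        exists_or, exists_eq_left, or_assoc]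
    · intro x hx
      refine ⟨fun h => h.resolve_right fun h' => ?_, Or.inl⟩
      simp only [mem_iUnion, exists_prop] at h'
      obtain ⟨f, hf, hxf⟩ := h'
      have hne : f ≠ e := fun h => hl.2.2 f hf e (by simp) h
      exact Set.disjoint_left.1 (hdisj f (hsubl f hf) e hel hne) (hsub f (hsubl f hf) _ hxf) hx

/-- The union of the extensions of the horizontal segments, if they are extended first. -/
def hRays : Set Plane := ⋃ e : M.HEdge, M.newRays ∅ e.1

variable {M} {h v : List (Sym2 Plane)}

lemma mem_h_iff (hl : M.IsOrdering (h ++ v)) (hh : ∀ e ∈ h, IsHorizontal e)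
    (hv : ∀ e ∈ v, IsVertical e) {e : Sym2 Plane} : e ∈ h ↔ e ∈ M.edges ∧ IsHorizontal e := by
  constructor
  · exact fun he => ⟨(hl.2 e).1 (List.mem_append_left _ he), hh e he⟩
  · rintro ⟨he, heh⟩
    exact (List.mem_append.1 ((hl.2 e).2 he)).resolve_right fun h' => not_h_and_v he heh (hv e h')

lemma mem_v_iff (hl : M.IsOrdering (h ++ v)) (hh : ∀ e ∈ h, IsHorizontal e)
    (hv : ∀ e ∈ v, IsVertical e) {e : Sym2 Plane} : e ∈ v ↔ e ∈ M.edges ∧ IsVertical e := by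
  constructor
  · exact fun he => ⟨(hl.2 e).1 (List.mem_append_right _ he), hv e he⟩
  · rintro ⟨he, heh⟩
    exact (List.mem_append.1 ((hl.2 e).2 he)).resolve_left fun h' => not_h_and_v he (hh e h') heh

/-- General position puts parallel segments on distinct lines, so the order within each direction
does not matter. -/
lemma extension_eq (hl : M.IsOrdering (h ++ v)) (hh : ∀ e ∈ h, IsHorizontal e)
    (hv : ∀ e ∈ v, IsVertical e) :
    M.extension (h ++ v) = M.hRays ∪ ⋃ e : M.VEdge, M.newRays M.hRays e.1 := by
  have hmh : ∀ {e}, e ∈ h ↔ _ := mem_h_iff hl hh hv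
  have hmv : ∀ {e}, e ∈ v ↔ _ := mem_v_iff hl hh hv
  have hnd := List.nodup_append.1 hl.1
  have e1 : h.foldl (fun prev e => prev ∪ M.newRays prev e) ∅ = M.hRays := by
    rw [M.foldl_newRays (fun e => {p | p.2 = ymin e}) ∅ h hnd.1, hRays, empty_union]
    · ext x
      simp only [mem_iUnion, Subtype.exists, exists_prop, hmh]
    · intro e he P x hx
      rw [hmh] at he
      exact ((M.mem_newRays_h he.2 (M.not_isDiag e he.1) P).1 hx).1
    · intro e he P P' hPP
      rw [hmh] at he
      have : ∀ f, (f, ymin e) ∈ M.obstacles P e ↔ (f, ymin e) ∈ M.obstacles P' e := fun f => by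
        rw [mem_obstacles, mem_obstacles, hPP (f, ymin e) rfl]
      ext x
      simp only [M.mem_newRays_h he.2 (M.not_isDiag e he.1), this]
    · intro e he f hf hne
      rw [hmh] at he hf
      refine Set.disjoint_left.2 fun x hx hx' => hne ?_
      exact eq_of_h_of_mem he.1 he.2 hf.1 (left_mem hf.1 hf.2) (hx'.symm.trans hx)
  rw [extension, List.foldl_append, e1,
    M.foldl_newRays (fun e => {p | p.1 = xmin e}) M.hRays v hnd.2.1]
  · congr 1
    ext x
    simp only [mem_iUnion, Subtype.exists, exists_prop, hmv]
  · intro e he P x hx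
    rw [hmv] at he
    exact ((M.mem_newRays_v he.2 (M.not_isDiag e he.1) P).1 hx).1
  · intro e he P P' hPP
    rw [hmv] at he
    have : ∀ f, (xmin e, f) ∈ M.obstacles P e ↔ (xmin e, f) ∈ M.obstacles P' e := fun f => by
      rw [mem_obstacles, mem_obstacles, hPP (xmin e, f) rfl]
    ext x
    simp only [M.mem_newRays_v he.2 (M.not_isDiag e he.1), this]
  · intro e he f hf hne
    rw [hmv] at he hf
    refine Set.disjoint_left.2 fun x hx hx' => hne ?_
    exact eq_of_v_of_mem he.1 he.2 hf.1 (bottom_mem hf.1 hf.2) (hx'.symm.trans hx)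

end PerfectMatching

/-! ### The drawing as a segment system -/

/-- A segment with the two rays up to the first obstacle is the extended interval. -/
lemma mem_extendInterval_iff {p q x : ℝ} {F O : Set ℝ} (hO : ∀ f, f ≤ p ∨ q ≤ f → (f ∈ O ↔ f ∈ F)) (hpq : p < q) :
    x ∈ extendInterval p q F ↔ (p ≤ x ∧ x ≤ q) ∨
      ((q ≤ x ∧ ∀ f, f ∈ O → q ≤ f → x ≤ f) ∨ (x ≤ p ∧ ∀ f, f ∈ O → f ≤ p → f ≤ x)) := by
  constructor
  · intro hx
    rcases le_total x p with h | h
    · exact Or.inr (Or.inr ⟨h, fun f hf hfp => (hx f ((hO f (Or.inl hfp)).1 hf)).2 hfp⟩)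
    · rcases le_total x q with h' | h'
      · exact Or.inl ⟨h, h'⟩
      · exact Or.inr (Or.inl ⟨h', fun f hf hfp => (hx f ((hO f (Or.inr hfp)).1 hf)).1 hfp⟩)
  · rintro (⟨h1, h2⟩ | ⟨h1, h2⟩ | ⟨h1, h2⟩)
    · exact mem_extendInterval_of_mem_Icc h1 h2
    · exact fun f hf => ⟨fun h => h2 f ((hO f (Or.inr h)).2 hf) h, fun h => by linarith⟩
    · exact fun f hf => ⟨fun h => by linarith, fun h => h2 f ((hO f (Or.inl h)).2 hf) h⟩

namespace PerfectMatching

variable {M : PerfectMatching} {h v : List (Sym2 Plane)}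

lemma mem_hExt_iff (hM : ∀ e ∈ M.edges, IsHorizontal e ∨ IsVertical e) (i : M.HEdge) {p : Plane} :
    p.2 = ymin i.1 ∧ p.1 ∈ M.segFamily.hExt i ↔ p ∈ closedSeg i.1 ∨ p ∈ M.newRays ∅ i.1 := by
  have hd := M.not_isDiag _ i.2.1
  rw [mem_closedSeg_h i.2.2 hd, M.mem_newRays_h i.2.2 hd, ← and_or_left]
  refine and_congr_right fun hp => ?_
  refine mem_extendInterval_iff (O := {f | (f, ymin i.1) ∈ M.obstacles ∅ i.1}) ?_
    (M.segFamily.xl_lt i)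
  · intro f _
    rw [mem_ofPred_eq, mem_obstacles]
    constructor
    · rintro (⟨e, he, hne, hfe⟩ | h)
      · rcases hM e he with heh | hev
        · rw [mem_closedSeg_h heh (M.not_isDiag e he)] at hfe
          exact absurd (eq_of_h_of_mem he heh i.2.1 (left_mem i.2.1 i.2.2) hfe.1) hne
        · rw [mem_closedSeg_v hev (M.not_isDiag e he)] at hfe
          exact ⟨⟨e, he, hev⟩, hfe⟩
      · exact h.elim
    · rintro ⟨j, rfl, hj⟩
      refine Or.inl ⟨j.1, j.2.1, fun e => not_h_and_v i.2.1 i.2.2 (e ▸ j.2.2), ?_⟩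
      rw [mem_closedSeg_v j.2.2 (M.not_isDiag _ j.2.1)]
      exact ⟨rfl, hj⟩

lemma mem_vExt_iff (hM : ∀ e ∈ M.edges, IsHorizontal e ∨ IsVertical e) (j : M.VEdge) {p : Plane} :
    p.1 = xmin j.1 ∧ p.2 ∈ M.segFamily.vExt j ↔ p ∈ closedSeg j.1 ∨ p ∈ M.newRays M.hRays j.1 := by
  have hd := M.not_isDiag _ j.2.1
  rw [mem_closedSeg_v j.2.2 hd, M.mem_newRays_v j.2.2 hd, ← and_or_left]
  refine and_congr_right fun hp => ?_
  refine mem_extendInterval_iff (O := {f | (xmin j.1, f) ∈ M.obstacles M.hRays j.1}) ?_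
    (M.segFamily.yb_lt j)
  · intro f hf
    rw [mem_ofPred_eq, mem_obstacles]
    constructor
    · intro hO
      have : ∃ i, f = M.segFamily.Y i ∧ M.segFamily.X j ∈ M.segFamily.hExt i := by
        rcases hO with ⟨e, he, hne, hfe⟩ | h
        · rcases hM e he with heh | hev
          · exact ⟨⟨e, he, heh⟩, (mem_hExt_iff hM ⟨e, he, heh⟩).2 (Or.inl hfe)⟩
          · rw [mem_closedSeg_v hev (M.not_isDiag e he)] at hfe
            exact absurd (eq_of_v_of_mem he hev j.2.1 (bottom_mem j.2.1 j.2.2) hfe.1) hne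
        · obtain ⟨i, hi⟩ := mem_iUnion.1 h
          exact ⟨i, (mem_hExt_iff hM i).2 (Or.inr hi)⟩
      -- Only heights outside the open segment are tested, so a height on the segment would be that
      -- of an endpoint, which no horizontal segment shares.
      refine ⟨this, fun h => ?_⟩
      obtain ⟨i, rfl, -⟩ := this
      rcases hf with hf | hf
      · exact M.segFamily.yb_ne i j (le_antisymm h.1 hf)
      · exact M.segFamily.yt_ne i j (le_antisymm hf h.2)
    · rintro ⟨⟨i, hi⟩, -⟩
      rcases (mem_hExt_iff hM i (p := (xmin j.1, f))).1 hi with h | h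
      · exact Or.inl ⟨i.1, i.2.1, fun e => not_h_and_v i.2.1 i.2.2 (e ▸ j.2.2), h⟩
      · exact Or.inr (mem_iUnion.2 ⟨i, h⟩)

lemma drawing_eq (hM : ∀ e ∈ M.edges, IsHorizontal e ∨ IsVertical e)
    (hl : M.IsOrdering (h ++ v)) (hh : ∀ e ∈ h, IsHorizontal e) (hv : ∀ e ∈ v, IsVertical e) :
    M.drawing (h ++ v) = M.segFamily.system.D := by
  have hD : ∀ p, p ∈ M.segFamily.system.D ↔
      (∃ i : M.HEdge, p ∈ closedSeg i.1 ∨ p ∈ M.newRays ∅ i.1) ∨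
      ∃ j : M.VEdge, p ∈ closedSeg j.1 ∨ p ∈ M.newRays M.hRays j.1 := fun p =>
    or_congr (exists_congr fun i => mem_hExt_iff hM i) (exists_congr fun j => mem_vExt_iff hM j)
  ext p
  rw [hD, drawing, extension_eq hl hh hv, hRays]
  simp only [mem_union, mem_iUnion, exists_prop]
  constructor
  · rintro (⟨e, he, hp⟩ | ⟨i, hi⟩ | ⟨j, hj⟩)
    · rcases hM e he with heh | hev
      · exact Or.inl ⟨⟨e, he, heh⟩, Or.inl hp⟩
      · exact Or.inr ⟨⟨e, he, hev⟩, Or.inl hp⟩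
    · exact Or.inl ⟨i, Or.inr hi⟩
    · exact Or.inr ⟨j, Or.inr hj⟩
  · rintro (⟨i, hi | hi⟩ | ⟨j, hj | hj⟩)
    · exact Or.inl ⟨i.1, i.2.1, hi⟩
    · exact Or.inr (Or.inl ⟨i, hi⟩)
    · exact Or.inl ⟨j.1, j.2.1, hj⟩
    · exact Or.inr (Or.inr ⟨j, hj⟩)

/-! ### Endpoints as openings, and the two trees -/

lemma mem_leftBottom_iff {p : Plane} : p ∈ M.leftBottom ↔
    p ∈ M.segFamily.system.openings M.segFamily.xl M.segFamily.yb := by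
  constructor
  · rintro ⟨w, he, ⟨h1, h2⟩ | ⟨h1, h2⟩⟩
    · have hh : IsHorizontal s(p, w) := by
        intro a ha b hb
        rcases Sym2.mem_iff.1 ha with rfl | rfl <;> rcases Sym2.mem_iff.1 hb with rfl | rfl <;>
          simp [h1]
      refine Or.inl ⟨⟨_, he, hh⟩, ?_⟩
      change p = (min p.1 w.1, min p.2 w.2)
      rw [min_eq_left h2.le, min_eq_left h1.le]
    · have hh : IsVertical s(p, w) := by
        intro a ha b hb
        rcases Sym2.mem_iff.1 ha with rfl | rfl <;> rcases Sym2.mem_iff.1 hb with rfl | rfl <;>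
          simp [h1]
      refine Or.inr ⟨⟨_, he, hh⟩, ?_⟩
      change p = (min p.1 w.1, min p.2 w.2)
      rw [min_eq_left h2.le, min_eq_left h1.le]
  · rintro (⟨i, rfl⟩ | ⟨j, rfl⟩)
    · obtain ⟨h1, h2⟩ := i.2.2.eq_mk (M.not_isDiag _ i.2.1)
      exact ⟨(xmax i.1, ymin i.1), h1 ▸ i.2.1, Or.inl ⟨rfl, h2⟩⟩
    · obtain ⟨h1, h2⟩ := j.2.2.eq_mk (M.not_isDiag _ j.2.1)
      exact ⟨(xmin j.1, ymax j.1), h1 ▸ j.2.1, Or.inr ⟨rfl, h2⟩⟩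

lemma mem_rightTop_iff {p : Plane} : p ∈ M.rightTop ↔
    -p ∈ M.segFamily.neg.system.openings M.segFamily.neg.xl M.segFamily.neg.yb := by
  constructor
  · rintro ⟨w, he, ⟨h1, h2⟩ | ⟨h1, h2⟩⟩
    · have hh : IsHorizontal s(p, w) := by
        intro a ha b hb
        rcases Sym2.mem_iff.1 ha with rfl | rfl <;> rcases Sym2.mem_iff.1 hb with rfl | rfl <;>
          simp [h1]
      refine Or.inl ⟨⟨_, he, hh⟩, ?_⟩
      change -p = (-max p.1 w.1, -min p.2 w.2)
      rw [max_eq_left h2.le, min_eq_left h1.le]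
      rfl
    · have hh : IsVertical s(p, w) := by
        intro a ha b hb
        rcases Sym2.mem_iff.1 ha with rfl | rfl <;> rcases Sym2.mem_iff.1 hb with rfl | rfl <;>
          simp [h1]
      refine Or.inr ⟨⟨_, he, hh⟩, ?_⟩
      change -p = (-min p.1 w.1, -max p.2 w.2)
      rw [max_eq_left h2.le, min_eq_left h1.le]
      rfl
  · rintro (⟨i, hp⟩ | ⟨j, hp⟩)
    · obtain ⟨h1, h2⟩ := i.2.2.eq_mk (M.not_isDiag _ i.2.1)
      have : p = (xmax i.1, ymin i.1) := neg_injective hp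
      subst this
      exact ⟨(xmin i.1, ymin i.1), by rw [Sym2.eq_swap]; exact h1 ▸ i.2.1, Or.inl ⟨rfl, h2⟩⟩
    · obtain ⟨h1, h2⟩ := j.2.2.eq_mk (M.not_isDiag _ j.2.1)
      have : p = (xmin j.1, ymax j.1) := neg_injective hp
      subst this
      exact ⟨(xmin j.1, ymin j.1), by rw [Sym2.eq_swap]; exact h1 ▸ j.2.1, Or.inr ⟨rfl, h2⟩⟩

lemma leftBottom_or_rightTop (hM : ∀ e ∈ M.edges, IsHorizontal e ∨ IsVertical e) {a b : Plane}
    (he : s(a, b) ∈ M.edges) :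
    (a ∈ M.leftBottom ∧ b ∈ M.rightTop) ∨ (a ∈ M.rightTop ∧ b ∈ M.leftBottom) := by
  have hne : a ≠ b := fun h => M.not_isDiag _ he (by simp [h])
  have he' : s(b, a) ∈ M.edges := by rwa [Sym2.eq_swap]
  rcases hM _ he with h | h
  · have h2 : a.2 = b.2 := h _ (Sym2.mem_mk_left _ _) _ (Sym2.mem_mk_right _ _)
    rcases lt_or_gt_of_ne fun h1 => hne (Prod.ext h1 h2) with hlt | hlt
    · exact Or.inl ⟨⟨b, he, Or.inl ⟨h2, hlt⟩⟩, a, he', Or.inl ⟨h2.symm, hlt⟩⟩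
    · exact Or.inr ⟨⟨b, he, Or.inl ⟨h2, hlt⟩⟩, a, he', Or.inl ⟨h2.symm, hlt⟩⟩
  · have h2 : a.1 = b.1 := h _ (Sym2.mem_mk_left _ _) _ (Sym2.mem_mk_right _ _)
    rcases lt_or_gt_of_ne fun h1 => hne (Prod.ext h2 h1) with hlt | hlt
    · exact Or.inl ⟨⟨b, he, Or.inr ⟨h2, hlt⟩⟩, a, he', Or.inr ⟨h2.symm, hlt⟩⟩
    · exact Or.inr ⟨⟨b, he, Or.inr ⟨h2, hlt⟩⟩, a, he', Or.inr ⟨h2.symm, hlt⟩⟩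

lemma disjoint_leftBottom_rightTop : Disjoint M.leftBottom M.rightTop := by
  refine Set.disjoint_left.2 ?_
  rintro p ⟨w, he, h⟩ ⟨w', he', h'⟩
  obtain rfl : w = w' := Sym2.congr_right.1
    (eq_of_mem_mem he he' (Sym2.mem_mk_left p w) (Sym2.mem_mk_left p w'))
  rcases h with ⟨h1, h2⟩ | ⟨h1, h2⟩ <;> rcases h' with ⟨h3, h4⟩ | ⟨h3, h4⟩ <;> linarith

lemma mem_verts_of_leftBottom {p : Plane} (hp : p ∈ M.leftBottom) : p ∈ M.verts := by
  obtain ⟨w, he, -⟩ := hp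
  exact M.mem_verts _ he _ (Sym2.mem_mk_left p w)

lemma mem_verts_of_rightTop {p : Plane} (hp : p ∈ M.rightTop) : p ∈ M.verts := by
  obtain ⟨w, he, -⟩ := hp
  exact M.mem_verts _ he _ (Sym2.mem_mk_left p w)

lemma mem_leftBottom_or_mem_rightTop (hM : ∀ e ∈ M.edges, IsHorizontal e ∨ IsVertical e) {p : Plane}
    (hp : p ∈ M.verts) : p ∈ M.leftBottom ∨ p ∈ M.rightTop := by
  obtain ⟨e, ⟨he, hpe⟩, -⟩ := M.degree_one p hp
  obtain ⟨w, rfl⟩ := hpe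
  exact (leftBottom_or_rightTop hM he).imp And.left And.left

/-- Every vertex of the matching is an edge of the dual multigraph. -/
lemma edgeSet_dual (hM : ∀ e ∈ M.edges, IsHorizontal e ∨ IsVertical e)
    (hl : M.IsOrdering (h ++ v)) (hh : ∀ e ∈ h, IsHorizontal e) (hv : ∀ e ∈ v, IsVertical e) :
    (M.dual (h ++ v)).edgeSet = M.verts := by
  have hD := drawing_eq hM hl hh hv
  ext p
  rw [Graph.edge_mem_iff_exists_isLink]
  constructor
  · rintro ⟨x, y, hp, -⟩; exact hp
  · intro hp
    suffices ∃ x y, x ≠ y ∧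
        {c | c ∈ complCells (M.drawing (h ++ v)) ∧ p ∈ frontier c} = {x, y} by
      obtain ⟨x, y, hxy⟩ := this
      exact ⟨x, y, hp, hxy⟩
    rcases mem_leftBottom_or_mem_rightTop hM hp with hp' | hp'
    · rw [hD]
      exact M.segFamily.openings_system.exists_pair (Homeomorph.refl Plane)
        (mem_leftBottom_iff.1 hp')
    · rw [hD, M.segFamily.neg_system_D]
      exact M.segFamily.neg.openings_system.exists_pair (Homeomorph.neg Plane)
        (mem_rightTop_iff.1 hp')

lemma isTree_leftBottom (hM : ∀ e ∈ M.edges, IsHorizontal e ∨ IsVertical e)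
    (hl : M.IsOrdering (h ++ v)) (hh : ∀ e ∈ h, IsHorizontal e) (hv : ∀ e ∈ v, IsVertical e) :
    MultigraphIsTree ((M.dual (h ++ v)).restrict M.leftBottom) := by
  refine M.segFamily.openings_system.multigraphIsTree (Homeomorph.refl Plane)
    (D := M.drawing (h ++ v)) (drawing_eq hM hl hh hv) _ rfl fun p x y => ?_
  rw [Graph.restrict_isLink]
  change p ∈ M.leftBottom ∧ p ∈ M.verts ∧ _ ↔ p ∈ M.segFamily.system.openings _ _ ∧ _
  rw [← mem_leftBottom_iff]
  exact and_congr_right fun hp => ⟨And.right, fun h => ⟨mem_verts_of_leftBottom hp, h⟩⟩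

/-- The half turn maps horizontal extensions to horizontal ones, so the theorem on openings applies
to the reflected family. -/
lemma isTree_rightTop (hM : ∀ e ∈ M.edges, IsHorizontal e ∨ IsVertical e)
    (hl : M.IsOrdering (h ++ v)) (hh : ∀ e ∈ h, IsHorizontal e) (hv : ∀ e ∈ v, IsVertical e) :
    MultigraphIsTree ((M.dual (h ++ v)).restrict M.rightTop) := by
  refine M.segFamily.neg.openings_system.multigraphIsTree (Homeomorph.neg Plane)
    (D := M.drawing (h ++ v)) ((drawing_eq hM hl hh hv).trans M.segFamily.neg_system_D) _ rfl
    fun p x y => ?_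
  rw [Graph.restrict_isLink]
  change p ∈ M.rightTop ∧ p ∈ M.verts ∧ _ ↔ -p ∈ M.segFamily.neg.system.openings _ _ ∧ _
  rw [← mem_rightTop_iff]
  exact and_congr_right fun hp => ⟨And.right, fun h => ⟨mem_verts_of_rightTop hp, h⟩⟩

open Classical in
lemma exists_ordering (hM : ∀ e ∈ M.edges, IsHorizontal e ∨ IsVertical e) :
    ∃ h v : List (Sym2 Plane), M.IsOrdering (h ++ v) ∧ (∀ e ∈ h, IsHorizontal e) ∧
      ∀ e ∈ v, IsVertical e := by
  refine ⟨M.edges.toList.filter (IsHorizontal ·), M.edges.toList.filter (¬ IsHorizontal ·),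
    ⟨?_, fun e => ?_⟩, fun e he => ?_, fun e he => ?_⟩
  · refine List.nodup_append.2 ⟨M.edges.nodup_toList.filter _, M.edges.nodup_toList.filter _, ?_⟩
    rintro a ha _ hb rfl
    simp only [List.mem_filter, decide_eq_true_eq] at ha hb
    exact hb.2 ha.2
  · simp only [List.mem_append, List.mem_filter, Finset.mem_toList, decide_eq_true_eq]
    tauto
  · simp only [List.mem_filter, decide_eq_true_eq] at he
    exact he.2
  · simp only [List.mem_filter, decide_eq_true_eq, Finset.mem_toList] at he
    exact (hM e he.1).resolve_left he.2

end PerfectMatching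

/-- Every perfect matching of horizontal and vertical segments satisfies the Two Trees Conjecture.
Moreover, if the horizontal segments are extended first, in any order, and then the vertical
segments, in any order, then every vertex of the matching is an edge of the dual multigraph, the
edges through left or bottom endpoints form a spanning tree of it, and so do the edges through
right or top endpoints. -/
theorem theorem2 (M : PerfectMatching)
    (hM : ∀ e ∈ M.edges, IsHorizontal e ∨ IsVertical e) :
    M.SatisfiesTwoTrees ∧
    ∀ h v : List (Sym2 Plane), M.IsOrdering (h ++ v) →
      (∀ e ∈ h, IsHorizontal e) → (∀ e ∈ v, IsVertical e) →
      (M.dual (h ++ v)).edgeSet = M.verts ∧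
      MultigraphIsTree ((M.dual (h ++ v)).restrict M.leftBottom) ∧
      MultigraphIsTree ((M.dual (h ++ v)).restrict M.rightTop) := by
  refine ⟨?_, fun h v hl hh hv => ⟨PerfectMatching.edgeSet_dual hM hl hh hv,
    PerfectMatching.isTree_leftBottom hM hl hh hv, PerfectMatching.isTree_rightTop hM hl hh hv⟩⟩
  obtain ⟨h, v, hl, hh, hv⟩ := PerfectMatching.exists_ordering hM
  have hE := PerfectMatching.edgeSet_dual hM hl hh hv
  have hmem : ∀ a b, s(a, b) ∈ M.edges → a ∈ (M.dual (h ++ v)).edgeSet ∧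
      b ∈ (M.dual (h ++ v)).edgeSet := fun a b he => by
    rw [hE]
    exact ⟨M.mem_verts _ he _ (Sym2.mem_mk_left _ _), M.mem_verts _ he _ (Sym2.mem_mk_right _ _)⟩
  refine ⟨h ++ v, hl, (M.dual (h ++ v)).restrict M.leftBottom,
    (M.dual (h ++ v)).restrict M.rightTop, Graph.restrict_le, Graph.restrict_le,
    PerfectMatching.isTree_leftBottom hM hl hh hv, PerfectMatching.isTree_rightTop hM hl hh hv,
    ?_, ?_, fun a b he => ?_⟩
  · exact (PerfectMatching.disjoint_leftBottom_rightTop (M := M)).mono inter_subset_right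
      inter_subset_right
  · rw [Graph.edgeSet_restrict, Graph.edgeSet_restrict, ← inter_union_distrib_left,
      inter_eq_left, hE]
    exact fun p hp => PerfectMatching.mem_leftBottom_or_mem_rightTop hM hp
  · obtain ⟨ha, hb⟩ := hmem a b he
    exact (PerfectMatching.leftBottom_or_rightTop hM he).imp
      (fun h => ⟨⟨ha, h.1⟩, hb, h.2⟩) fun h => ⟨⟨ha, h.1⟩, hb, h.2⟩
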